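/- **Setting.** Let $\mathsf{S}$ be a (finite-dimensional, smooth, real) Lie group with identity $e$ and Lie algebra $\mathfrak{s}$, and write $s_0\dot s = T\mathsf{L}_{s_0}(\dot s)$ for the tangent lift of the left translation $\mathsf{L}_{s_0}$. Let $X$ be a finite-dimensional real vector space with a smooth representation $(s,\mathsf{x})\mapsto s\mathsf{x}$ of $\mathsf{S}$, let $\mathsf{S}$ act on $X^*$ by $\langle s\gamma,\mathsf{x}\rangle=\langle\gamma,s^{-1}\mathsf{x}\rangle$, and let $(\xi,\mathsf{x})\mapsto\xi\mathsf{x}$ be the derived representation of $\mathfrak{s}$ on $X$, with $\langle\xi\gamma,\mathsf{x}\rangle=-\langle\gamma,\xi\mathsf{x}\rangle$ on $X^*$. Define $\mathbf{K}\colon X\times X^*\to\mathfrak{s}^*$ by $\langle\mathbf{K}(\mathsf{x},\Gamma),\xi\rangle=\langle\Gamma,\xi\mathsf{x}\rangle$, and $\mathrm{ad}^*_\xi$ by $\langle\mathrm{ad}^*_\xi\mu,\eta\rangle=\langle\mu,[\xi,\eta]\rangle$, where $[\cdot,\cdot]$ is the bracket of left-invariant vector fields. Fix $\gamma_0\in X^*$.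 Let $L_{\gamma_0}\colon T\mathsf{S}\to\mathbb{R}$ be a Lagrangian, let $\Psi^1_{\gamma_0},\dots,\Psi^r_{\gamma_0}$ be one-forms on $\mathsf{S}$, and let $\mathcal{D}_{\gamma_0}(s)=\bigcap_a\ker\Psi^a_{\gamma_0}(s)$. Neither $L_{\gamma_0}$ nor $\mathcal{D}_{\gamma_0}$ need be left $\mathsf{S}$-invariant, but assume that there are * a smooth function $L\colon T\mathsf{S}\times X^*\to\mathbb{R}$ with $L(\cdot,\gamma_0)=L_{\gamma_0}$ and $L(s_0s,s_0\dot s,s_0\gamma)=L(s,\dot s,\gamma)$ for all $s_0,s\in\mathsf{S}$, $\dot s\in T_s\mathsf{S}$, $\gamma\in X^*$; * one-forms $\Psi^a(\cdot,\gamma)$ on $\mathsf{S}$ ($a=1,\dots,r$), depending smoothly on $s\in\mathsf{S}$ and $\gamma\in X^*$, with $\Psi^a(\cdot,\gamma_0)=\Psi^a_{\gamma_0}$ and $(\mathsf{L}_{s_0}^*\Psi^a)(\cdot,s_0\gamma)=\Psi^a(\cdot,\gamma)$ for all $s_0\in\mathsf{S}$, $\gamma\in X^*$. Put $\ell(\xi,\Gamma)=L(e,\xi,\Gamma)$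 and $\psi^a(\Gamma)=\Psi^a(e,\Gamma)\in\mathfrak{s}^*$. Let $t_0<t_1$, let $s\colon[t_0,t_1]\to\mathsf{S}$ be a smooth curve along which $\mathcal{D}_{\gamma_0}$ has corank $r$ (that is, $\Psi^1_{\gamma_0}(s(t)),\dots,\Psi^r_{\gamma_0}(s(t))$ are linearly independent for every $t$), and let $\xi(t)=s(t)^{-1}\dot s(t)\in\mathfrak{s}$. **Statement.** The following are equivalent. 1. (*Lagrange–d'Alembert principle*) $\dot s(t)\in\mathcal{D}_{\gamma_0}(s(t))$ for all $t\in[t_0,t_1]$, and $\delta\int_{t_0}^{t_1}L_{\gamma_0}(s,\dot s)\,dt=0$ subject to $\delta s(t_0)=\delta s(t_1)=0$ and $\delta s(t)\in\mathcal{D}_{\gamma_0}(s(t))$ for $t\in(t_0,t_1)$; that is, $\frac{d}{d\varepsilon}\big|_{\varepsilon=0}\int_{t_0}^{t_1}L_{\gamma_0}(s_\varepsilon,\dot s_\varepsilon)\,dt=0$ for every smooth deformation $s_\varepsilon$ of $s_0=s$ on $[t_0,t_1]$ whose variation $\delta s=\partial_\varepsilon s_\varepsilon|_{\varepsilon=0}$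 satisfies these conditions. 2. (*Reduced principle*) With $\Gamma(t)=s(t)^{-1}\gamma_0$ one has $\langle\psi^a(\Gamma(t)),\xi(t)\rangle=0$ for all $t\in[t_0,t_1]$ and all $a$, and $\delta\int_{t_0}^{t_1}\ell(\xi,\Gamma)\,dt=0$ for all variations of the form $\delta\xi=\dot\eta+[\xi,\eta]$, $\delta\Gamma=-\eta\Gamma$, where $\eta\colon[t_0,t_1]\to\mathfrak{s}$ is any smooth curve with $\eta(t_0)=\eta(t_1)=0$ and $\langle\psi^a(\Gamma(t)),\eta(t)\rangle=0$ for all $t$ and $a$; that is, $\frac{d}{d\varepsilon}\big|_{\varepsilon=0}\int_{t_0}^{t_1}\ell(\xi_\varepsilon,\Gamma_\varepsilon)\,dt=0$ for every smooth deformation $(\xi_\varepsilon,\Gamma_\varepsilon)$ of $(\xi,\Gamma)$ in $\mathfrak{s}\times X^*$ with such $\partial_\varepsilon\xi_\varepsilon|_{\varepsilon=0}=\delta\xi$ and $\partial_\varepsilon\Gamma_\varepsilon|_{\varepsilon=0}=\delta\Gamma$. 3. (*Nonholonomic Euler–Poincaré equations with advected parameter*) There are a curve $\Gamma\colon[t_0,t_1]\to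 X^*$ with $\Gamma(t_0)=s(t_0)^{-1}\gamma_0$ and functions $\lambda_1,\dots,\lambda_r\colon[t_0,t_1]\to\mathbb{R}$ (Lagrange multipliers) such that, on $[t_0,t_1]$, $\langle\psi^a(\Gamma),\xi\rangle=0$ for all $a$ and $$\frac{d}{dt}\Big(\frac{\delta\ell}{\delta\xi}\Big)=\mathrm{ad}^*_\xi\frac{\delta\ell}{\delta\xi}+\mathbf{K}\Big(\frac{\delta\ell}{\delta\Gamma},\Gamma\Big)+\sum_{a=1}^r\lambda_a\psi^a(\Gamma),\qquad\dot\Gamma=-\xi\Gamma .$$ Moreover, a curve $\Gamma\colon[t_0,t_1]\to X^*$ satisfies $\dot\Gamma=-\xi\Gamma$ and $\Gamma(t_0)=s(t_0)^{-1}\gamma_0$ if and only if $\Gamma(t)=s(t)^{-1}\gamma_0$ for all $t\in[t_0,t_1]$, so the curves $\Gamma$ in 2 and 3 are the same. -/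

import Mathlib

open Set MeasureTheory
open scoped Manifold ContDiff

noncomputable section

namespace BrokenSymmetry

variable {E : Type*} [NormedAddCommGroup E] [NormedSpace ℝ E]
  {H : Type*} [TopologicalSpace H] {I : ModelWithCorners ℝ E H}
  {S : Type*} [TopologicalSpace S] [ChartedSpace H S] [Group S]
  {X : Type*} [NormedAddCommGroup X] [NormedSpace ℝ X] {r : ℕ}

/-- A smooth Lie group is in particular smooth enough for Mathlib's Lie algebra structure on
`GroupLieAlgebra I S`, the tangent space at the identity with the bracket of left-invariant
vector fields. -/
instance lieGroup_minSmoothness [LieGroup I ∞ S] : LieGroup I (minSmoothness ℝ 3) S :=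
  LieGroup.of_le (n := ∞) (by
    rw [minSmoothness_of_isRCLikeNormedField]
    exact ENat.LEInfty.out)

/-- The tangent space at the identity with the norm of the model space. The topology and the
vector space structure are those which the tangent space already carries. -/
instance normedAddCommGroupLieAlgebra : NormedAddCommGroup (GroupLieAlgebra I S) :=
  { (inferInstance : AddCommGroup (GroupLieAlgebra I S)) with
    norm := fun v => ‖(show E from v)‖
    toMetricSpace := @MetricSpace.replaceTopology (GroupLieAlgebra I S)
      (inferInstanceAs (TopologicalSpace (TangentSpace I (1 : S))))
      (inferInstanceAs (MetricSpace E)) rfl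
    dist_eq := fun v w => NormedAddGroup.dist_eq (show E from v) (show E from w) }

instance normedSpaceLieAlgebra : NormedSpace ℝ (GroupLieAlgebra I S) :=
  { (inferInstance : Module ℝ (GroupLieAlgebra I S)) with
    norm_smul_le := fun c v => norm_smul_le c (show E from v) }

instance finiteDimensionalLieAlgebra [FiniteDimensional ℝ E] :
    FiniteDimensional ℝ (GroupLieAlgebra I S) :=
  inferInstanceAs (FiniteDimensional ℝ E)

/-! ### Representations -/

/-- The representation of `S` on `X*` induced by `ρ`: `⟨s γ, x⟩ = ⟨γ, s⁻¹ x⟩`. -/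
def dualAct (ρ : S →* (X →L[ℝ] X)) (s : S) (γ : StrongDual ℝ X) : StrongDual ℝ X :=
  γ.comp (ρ s⁻¹)

/-- The derived Lie algebra representation: `ξ x` is the derivative at the identity, in the
direction `ξ`, of `s ↦ s x`. -/
def algAct (I : ModelWithCorners ℝ E H) (ρ : S →* (X →L[ℝ] X)) :
    GroupLieAlgebra I S →L[ℝ] (X →L[ℝ] X) :=
  mfderiv I 𝓘(ℝ, X →L[ℝ] X) (fun s : S => ρ s) 1

/-- The induced Lie algebra representation on `X*`: `⟨ξ γ, x⟩ = -⟨γ, ξ x⟩`. -/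
def algDualAct (ρ : S →* (X →L[ℝ] X)) (ξ : GroupLieAlgebra I S) (γ : StrongDual ℝ X) :
    StrongDual ℝ X :=
  -(γ.comp (algAct I ρ ξ))

/-- The momentum map `K : X × X* → 𝔰*`, `⟨K(x, Γ), ξ⟩ = ⟨Γ, ξ x⟩`. -/
def momentumMap (ρ : S →* (X →L[ℝ] X)) (x : X) (Γ : StrongDual ℝ X) :
    StrongDual ℝ (GroupLieAlgebra I S) :=
  (Γ.comp (ContinuousLinearMap.apply ℝ X x)).comp (algAct I ρ)

/-- The coadjoint operator: `⟨ad*_ξ μ, η⟩ = ⟨μ, [ξ, η]⟩`. -/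
def coad [FiniteDimensional ℝ E] [LieGroup I ∞ S] (ξ : GroupLieAlgebra I S)
    (μ : StrongDual ℝ (GroupLieAlgebra I S)) : StrongDual ℝ (GroupLieAlgebra I S) :=
  LinearMap.toContinuousLinearMap
    (μ.toLinearMap ∘ₗ (LieAlgebra.ad ℝ (GroupLieAlgebra I S) ξ : _ →ₗ[ℝ] _))

/-- The functional derivative of a smooth function `f` on `X*`, as an element of `X ≅ X**`. -/
def dualFunctionalDeriv [FiniteDimensional ℝ X] (f : StrongDual ℝ X → ℝ) (Γ : StrongDual ℝ X) :
    X :=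
  (Module.evalEquiv ℝ X).symm ((fderiv ℝ f Γ).toLinearMap ∘ₗ
    (LinearMap.toContinuousLinearMap : Module.Dual ℝ X ≃ₗ[ℝ] StrongDual ℝ X).toLinearMap)

lemma apply_dualFunctionalDeriv [FiniteDimensional ℝ X] (f : StrongDual ℝ X → ℝ)
    (Γ γ : StrongDual ℝ X) : γ (dualFunctionalDeriv f Γ) = fderiv ℝ f Γ γ := by
  have h := Module.apply_evalEquiv_symm_apply (R := ℝ) (M := X) γ.toLinearMap
    ((fderiv ℝ f Γ).toLinearMap ∘ₗ
      (LinearMap.toContinuousLinearMap : Module.Dual ℝ X ≃ₗ[ℝ] StrongDual ℝ X).toLinearMap)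
  exact h

/-! ### Recovered symmetry -/

/-- `L : TS × X* → ℝ` is a smooth extension of the Lagrangian `L₀ : TS → ℝ` (that is,
`L(·, γ₀) = L₀`) which is left `S`-invariant when `S` also acts on the parameter. -/
structure RecoversLagrangian [LieGroup I ∞ S] (ρ : S →* (X →L[ℝ] X)) (γ₀ : StrongDual ℝ X)
    (L₀ : TangentBundle I S → ℝ) (L : TangentBundle I S → StrongDual ℝ X → ℝ) : Prop where
  smooth : ContMDiff (I.tangent.prod 𝓘(ℝ, StrongDual ℝ X)) 𝓘(ℝ, ℝ) ∞
    (fun p : TangentBundle I S × StrongDual ℝ X => L p.1 p.2)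
  extends_base : ∀ v, L v γ₀ = L₀ v
  invariant : ∀ (s₀ : S) (v : TangentBundle I S) (γ : StrongDual ℝ X),
    L (tangentMap I I (fun s => s₀ * s) v) (dualAct ρ s₀ γ) = L v γ

/-- `Ψ¹, …, Ψʳ` are one-forms on `S` with a parameter in `X*`, smooth in both arguments (as
functions on `TS × X*`), which extend the one-forms `Ψ₀ᵃ` defining the constraint distribution `D`
(that is, `Ψᵃ(·, γ₀) = Ψ₀ᵃ`) and are left `S`-invariant, `L_{s₀}^* Ψᵃ(·, s₀ γ) = Ψᵃ(·, γ)`. -/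
structure RecoversConstraints [LieGroup I ∞ S] (ρ : S →* (X →L[ℝ] X)) (γ₀ : StrongDual ℝ X)
    (D : (s : S) → Submodule ℝ (TangentSpace I s))
    (Ψ₀ : Fin r → (s : S) → TangentSpace I s →L[ℝ] ℝ)
    (Ψ : Fin r → (s : S) → StrongDual ℝ X → TangentSpace I s →L[ℝ] ℝ) : Prop where
  distribution : ∀ s v, v ∈ D s ↔ ∀ a, Ψ₀ a s v = 0
  smooth : ∀ a, ContMDiff (I.tangent.prod 𝓘(ℝ, StrongDual ℝ X)) 𝓘(ℝ, ℝ) ∞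
    (fun p : TangentBundle I S × StrongDual ℝ X => Ψ a p.1.proj p.2 p.1.snd)
  extends_base : ∀ a s, Ψ a s γ₀ = Ψ₀ a s
  invariant : ∀ (a : Fin r) (s₀ s : S) (γ : StrongDual ℝ X) (v : TangentSpace I s),
    Ψ a (s₀ * s) (dualAct ρ s₀ γ) (mfderiv I I (fun g => s₀ * g) s v) = Ψ a s γ v

/-- The reduced Lagrangian `ℓ(ξ, Γ) = L(e, ξ, Γ)`. -/
def reducedLagrangian (L : TangentBundle I S → StrongDual ℝ X → ℝ)
    (ξ : GroupLieAlgebra I S) (Γ : StrongDual ℝ X) : ℝ :=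
  L ⟨1, ξ⟩ Γ

/-- The reduced constraint covectors `ψᵃ(Γ) = Ψᵃ(e, Γ)`. -/
def reducedForm (Ψ : Fin r → (s : S) → StrongDual ℝ X → TangentSpace I s →L[ℝ] ℝ)
    (a : Fin r) (Γ : StrongDual ℝ X) : StrongDual ℝ (GroupLieAlgebra I S) :=
  Ψ a 1 Γ

/-! ### The three formulations -/

/-- The velocity `ṡ(t)` of a curve on `[t₀, t₁]` (one-sided at the end points). -/
def velocity (I : ModelWithCorners ℝ E H) (t₀ t₁ : ℝ) (s : ℝ → S) (t : ℝ) :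
    TangentSpace I (s t) :=
  mfderivWithin 𝓘(ℝ, ℝ) I s (Icc t₀ t₁) t (1 : ℝ)

/-- The infinitesimal variation `δs(t) = ∂/∂ε|_{ε=0} V(ε, t)`. -/
def variationField (I : ModelWithCorners ℝ E H) (V : ℝ → ℝ → S) (t : ℝ) :
    TangentSpace I (V 0 t) :=
  mfderiv 𝓘(ℝ, ℝ) I (fun ε => V ε t) 0 (1 : ℝ)

/-- The Lagrange–d'Alembert principle: `s` satisfies the constraint `ṡ ∈ D`, and
`d/dε|_{ε=0} ∫ L₀(s_ε, ṡ_ε) dt = 0` for every smooth deformation `s_ε = V(ε, ·)` of `s` with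
`δs(t₀) = δs(t₁) = 0` and `δs ∈ D`. -/
def LagrangeDAlembert (L₀ : TangentBundle I S → ℝ)
    (D : (s : S) → Submodule ℝ (TangentSpace I s)) (t₀ t₁ : ℝ) (s : ℝ → S) : Prop :=
  (∀ t ∈ Icc t₀ t₁, velocity I t₀ t₁ s t ∈ D (s t)) ∧
  ∀ (δ : ℝ) (V : ℝ → ℝ → S), 0 < δ →
    ContMDiffOn 𝓘(ℝ, ℝ × ℝ) I ∞ (fun p : ℝ × ℝ => V p.1 p.2) (Ioo (-δ) δ ×ˢ Icc t₀ t₁) →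
    (∀ t ∈ Icc t₀ t₁, V 0 t = s t) →
    variationField I V t₀ = 0 → variationField I V t₁ = 0 →
    (∀ t ∈ Ioo t₀ t₁, variationField I V t ∈ D (V 0 t)) →
    HasDerivAt (fun ε => ∫ t in t₀..t₁, L₀ ⟨V ε t, velocity I t₀ t₁ (V ε) t⟩) 0 0

/-- The reduced Lagrange–d'Alembert principle: `(ξ, Γ)` satisfies `⟨ψᵃ(Γ), ξ⟩ = 0`, and
`d/dε|_{ε=0} ∫ ℓ(ξ_ε, Γ_ε) dt = 0` for every smooth deformation `(ξ_ε, Γ_ε)` of `(ξ, Γ)` with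
`δξ = η̇ + [ξ, η]` and `δΓ = -η Γ`, where `η` is a smooth curve in the Lie algebra which vanishes
at `t₀` and `t₁` and satisfies `⟨ψᵃ(Γ), η⟩ = 0`. -/
def ReducedLagrangeDAlembert (ρ : S →* (X →L[ℝ] X))
    (l : GroupLieAlgebra I S → StrongDual ℝ X → ℝ)
    (ψ : Fin r → StrongDual ℝ X → StrongDual ℝ (GroupLieAlgebra I S)) (t₀ t₁ : ℝ)
    (ξ : ℝ → GroupLieAlgebra I S) (Γ : ℝ → StrongDual ℝ X) : Prop :=
  (∀ t ∈ Icc t₀ t₁, ∀ a, ψ a (Γ t) (ξ t) = 0) ∧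
  ∀ η : ℝ → GroupLieAlgebra I S, ContDiffOn ℝ ∞ η (Icc t₀ t₁) → η t₀ = 0 → η t₁ = 0 →
    (∀ t ∈ Icc t₀ t₁, ∀ a, ψ a (Γ t) (η t) = 0) →
    ∀ (δ : ℝ) (ξv : ℝ → ℝ → GroupLieAlgebra I S) (Γv : ℝ → ℝ → StrongDual ℝ X), 0 < δ →
      ContDiffOn ℝ ∞ (fun p : ℝ × ℝ => ξv p.1 p.2) (Ioo (-δ) δ ×ˢ Icc t₀ t₁) →
      ContDiffOn ℝ ∞ (fun p : ℝ × ℝ => Γv p.1 p.2) (Ioo (-δ) δ ×ˢ Icc t₀ t₁) →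
      (∀ t ∈ Icc t₀ t₁, ξv 0 t = ξ t) → (∀ t ∈ Icc t₀ t₁, Γv 0 t = Γ t) →
      (∀ t ∈ Icc t₀ t₁, HasDerivAt (fun ε => ξv ε t)
        (derivWithin η (Icc t₀ t₁) t + ⁅ξ t, η t⁆) 0) →
      (∀ t ∈ Icc t₀ t₁, HasDerivAt (fun ε => Γv ε t) (-(algDualAct ρ (η t) (Γ t))) 0) →
      HasDerivAt (fun ε => ∫ t in t₀..t₁, l (ξv ε t) (Γv ε t)) 0 0

/-- The advection equation `Γ̇ = -ξ Γ` on `[t₀, t₁]`. -/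
def Advected (ρ : S →* (X →L[ℝ] X)) (t₀ t₁ : ℝ)
    (ξ : ℝ → GroupLieAlgebra I S) (Γ : ℝ → StrongDual ℝ X) : Prop :=
  ∀ t ∈ Icc t₀ t₁, HasDerivWithinAt Γ (-(algDualAct ρ (ξ t) (Γ t))) (Icc t₀ t₁) t

/-- The nonholonomic Euler–Poincaré equations with advected parameter: `⟨ψᵃ(Γ), ξ⟩ = 0`,
`d/dt (δℓ/δξ) = ad*_ξ (δℓ/δξ) + K(δℓ/δΓ, Γ) + ∑ₐ λₐ ψᵃ(Γ)` for some multipliers `λₐ(t)`, and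
`Γ̇ = -ξ Γ`, on `[t₀, t₁]`. -/
def NonholonomicEulerPoincare [FiniteDimensional ℝ E] [FiniteDimensional ℝ X] [LieGroup I ∞ S]
    (ρ : S →* (X →L[ℝ] X)) (l : GroupLieAlgebra I S → StrongDual ℝ X → ℝ)
    (ψ : Fin r → StrongDual ℝ X → StrongDual ℝ (GroupLieAlgebra I S)) (t₀ t₁ : ℝ)
    (ξ : ℝ → GroupLieAlgebra I S) (Γ : ℝ → StrongDual ℝ X) : Prop :=
  (∀ t ∈ Icc t₀ t₁, ∀ a, ψ a (Γ t) (ξ t) = 0) ∧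
  (∃ lam : Fin r → ℝ → ℝ, ∀ t ∈ Icc t₀ t₁,
    HasDerivWithinAt (fun τ => fderiv ℝ (fun ζ => l ζ (Γ τ)) (ξ τ))
      (coad (ξ t) (fderiv ℝ (fun ζ => l ζ (Γ t)) (ξ t))
        + momentumMap ρ (dualFunctionalDeriv (fun γ => l (ξ t) γ) (Γ t)) (Γ t)
        + ∑ a, lam a t • ψ a (Γ t))
      (Icc t₀ t₁) t) ∧
  Advected ρ t₀ t₁ ξ Γ

end BrokenSymmetry

end

/-!
Left translation to the identity turns a curve `s` in the group into its reduced velocity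
`ξ = s⁻¹ ṡ` and the advected parameter `Γ = s⁻¹ γ₀`, and by the recovered invariance it turns the
Lagrangian and the constraints at `γ₀` into the reduced ones. Each of the three statements is shown
to be equivalent to the constraint `⟨ψᵃ(Γ), ξ⟩ = 0` together with one condition, that the first
variation of `∫ ℓ(ξ, Γ) dt` along `δξ = η̇ + [ξ, η]`, `δΓ = -η Γ` vanishes for all admissible `η`
(`IsConstrainedCritical`).

For the two variational principles this rests on `exists_reduced_deformation`: if `s_ε` is a
deformation of `s` and `η = s⁻¹ δs`, then the reduced curves `ξ_ε = s_ε⁻¹ ṡ_ε` and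
`Γ_ε = s_ε⁻¹ γ₀` have exactly the variations above. The formula for `δξ` is the Maurer–Cartan
equation (`maurerCartan`) for the logarithmic derivative `V⁻¹ dV` of `V(ε, t) = s_ε(t)`. Its proof
takes place in the chart at the identity: there `dV = R(V) (V⁻¹ dV)`, where `R(x) ξ` is the
left-invariant vector field through `ξ`, so symmetry of the second derivative of `V` expresses the
antisymmetrized derivative of `V⁻¹ dV` by the derivative of `R` at the identity, which is the
bracket. Conversely every `η` is the variation of some deformation (`exists_deformation`). As the
derivative of the action depends only on the first variation (`hasDerivAt_action`), one deformation
for each `η` is enough.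

For the Euler–Poincaré equations, integration by parts writes the first variation as `∫ ⟨A, η⟩ dt`,
where `A` is the defect of the unconstrained equation. Because the covectors `ψᵃ(Γ)` are linearly
independent, `A` has a smooth orthogonal decomposition along their span; testing with a multiple of
the component orthogonal to it shows that this component vanishes, and the coefficients of the other
one are the multipliers (`mem_span_of_integral_eq_zero`). Finally, `s⁻¹ γ₀` is the unique solution
of the advection equation because that equation is linear (`advected_iff`).
-/

open Filter Topology

namespace BrokenSymmetry

/-! ### Calculus of variations in vector spaces -/

/-- Differentiation under the integral sign for a `C¹` integrand on a rectangle. -/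
lemma hasDerivAt_intervalIntegral_of_contDiffOn {t₀ t₁ δ : ℝ} (ht : t₀ < t₁) (hδ : 0 < δ)
    {G : ℝ × ℝ → ℝ} (hG : ContDiffOn ℝ 1 G (Ioo (-δ) δ ×ˢ Icc t₀ t₁)) {g : ℝ → ℝ}
    (hg : ∀ t ∈ Icc t₀ t₁, HasDerivAt (fun ε => G (ε, t)) (g t) 0) :
    HasDerivAt (fun ε => ∫ t in t₀..t₁, G (ε, t)) (∫ t in t₀..t₁, g t) 0 := by
  set U : Set (ℝ × ℝ) := Ioo (-δ) δ ×ˢ Icc t₀ t₁ with hU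
  have hud : UniqueDiffOn ℝ U := (uniqueDiffOn_Ioo _ _).prod (uniqueDiffOn_Icc ht)
  set G' : ℝ × ℝ → ℝ := fun q => fderivWithin ℝ G U q (1, 0) with hG'
  have hG'c : ContinuousOn G' U :=
    (hG.continuousOn_fderivWithin hud le_rfl).clm_apply continuousOn_const
  have hder : ∀ ε ∈ Ioo (-δ) δ, ∀ t ∈ Icc t₀ t₁, HasDerivAt (fun x => G (x, t)) (G' (ε, t)) ε := by
    intro ε hε t htt
    have h1 : HasFDerivWithinAt G (fderivWithin ℝ G U (ε, t)) U (ε, t) :=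
      (hG.differentiableOn one_ne_zero (ε, t) ⟨hε, htt⟩).hasFDerivWithinAt
    have h2 : HasDerivWithinAt (fun x : ℝ => (x, t)) ((1 : ℝ), (0 : ℝ)) (Ioo (-δ) δ) ε :=
      ((hasDerivAt_id ε).prodMk (hasDerivAt_const ε t)).hasDerivWithinAt
    have hmaps : MapsTo (fun x : ℝ => (x, t)) (Ioo (-δ) δ) U := fun x hx => ⟨hx, htt⟩
    exact (h1.comp_hasDerivWithinAt ε h2 hmaps).hasDerivAt
      (Ioo_mem_nhds hε.1 hε.2)
  have hslice : ∀ {f : ℝ × ℝ → ℝ}, ContinuousOn f U → ∀ ε ∈ Ioo (-δ) δ,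
      ContinuousOn (fun t => f (ε, t)) (Icc t₀ t₁) := fun hf ε hε =>
    hf.comp (by fun_prop) fun t htt => ⟨hε, htt⟩
  have h0 : (0 : ℝ) ∈ Ioo (-δ) δ := ⟨by linarith, hδ⟩
  have huIoc : uIoc t₀ t₁ = Ioc t₀ t₁ := uIoc_of_le ht.le
  have hsub : Ioc t₀ t₁ ⊆ Icc t₀ t₁ := Ioc_subset_Icc_self
  -- a uniform bound for the derivative on a smaller compact rectangle
  obtain ⟨C, hC⟩ := ((isCompact_Icc (a := -(δ / 2)) (b := δ / 2)).prod
    (isCompact_Icc (a := t₀) (b := t₁))).exists_bound_of_continuousOn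
    (hG'c.mono (prod_mono (fun x hx => ⟨by linarith [hx.1], by linarith [hx.2]⟩) subset_rfl))
  have hmeas : ∀ {f : ℝ × ℝ → ℝ}, ContinuousOn f U → ∀ ε ∈ Ioo (-δ) δ,
      AEStronglyMeasurable (fun t => f (ε, t)) (volume.restrict (uIoc t₀ t₁)) := by
    intro f hf ε hε
    rw [huIoc]
    exact ((hslice hf ε hε).mono hsub).aestronglyMeasurable measurableSet_Ioc
  have key := (intervalIntegral.hasDerivAt_integral_of_dominated_loc_of_deriv_le
    (μ := volume) (a := t₀) (b := t₁) (F := fun ε t => G (ε, t)) (F' := fun ε t => G' (ε, t))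
    (x₀ := (0 : ℝ)) (s := Ioo (-(δ / 2)) (δ / 2)) (bound := fun _ => C)
    (Ioo_mem_nhds (by linarith) (by linarith))
    (by
      filter_upwards [Ioo_mem_nhds h0.1 h0.2] with ε hε
      exact hmeas hG.continuousOn ε hε)
    ((hslice hG.continuousOn 0 h0).intervalIntegrable_of_Icc ht.le)
    (hmeas hG'c 0 h0)
    (by
      refine ae_of_all _ fun t htt ε hε => ?_
      rw [huIoc] at htt
      exact hC (ε, t) ⟨Ioo_subset_Icc_self hε, hsub htt⟩)
    intervalIntegrable_const
    (by
      refine ae_of_all _ fun t htt ε hε => ?_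
      rw [huIoc] at htt
      exact hder ε ⟨by linarith [hε.1], by linarith [hε.2]⟩ t (hsub htt))).2
  have hcongr : ∫ t in t₀..t₁, G' (0, t) = ∫ t in t₀..t₁, g t := by
    refine intervalIntegral.integral_congr fun t htt => ?_
    rw [uIcc_of_le ht.le] at htt
    exact (hder 0 h0 t htt).unique (hg t htt)
  rwa [hcongr] at key

section Constraints

variable {E : Type*} [NormedAddCommGroup E] [NormedSpace ℝ E] [FiniteDimensional ℝ E]

/-- The dual of a finite-dimensional space has a Euclidean structure, given by a map `J : E* → E`
for which the quadratic form `⟨α, J α⟩` is positive definite. -/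
lemma exists_dual_euclidean (E : Type*) [NormedAddCommGroup E] [NormedSpace ℝ E]
    [FiniteDimensional ℝ E] :
    ∃ J : StrongDual ℝ E →L[ℝ] E, (∀ α : StrongDual ℝ E, 0 ≤ α (J α)) ∧
      ∀ α : StrongDual ℝ E, α (J α) = 0 → α = 0 := by
  let b := Module.finBasis ℝ E
  let J : StrongDual ℝ E →L[ℝ] E :=
    ∑ i, (ContinuousLinearMap.apply ℝ ℝ (b i)).smulRight (b i)
  have hJ : ∀ α β : StrongDual ℝ E, α (J β) = ∑ i, β (b i) * α (b i) := by
    intro α β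
    simp [J, _root_.sum_apply, map_sum]
  refine ⟨J, fun α => ?_, fun α h => ?_⟩
  · rw [hJ]
    exact Finset.sum_nonneg fun i _ => mul_self_nonneg _
  · rw [hJ, Finset.sum_eq_zero_iff_of_nonneg fun i _ => mul_self_nonneg _] at h
    have : (α : E →ₗ[ℝ] ℝ) = 0 := b.ext fun i => by simpa using h i (Finset.mem_univ i)
    ext x
    simpa using LinearMap.congr_fun this x

/-- The fundamental lemma of the calculus of variations for variations subject to independent
linear constraints `⟨ψᵃ(t), η(t)⟩ = 0`: a covector field which annihilates them in the mean is
at each time a combination of the constraint covectors. -/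
lemma mem_span_of_integral_eq_zero {r : ℕ} {t₀ t₁ : ℝ} (ht : t₀ < t₁)
    {A : ℝ → StrongDual ℝ E} (hA : ContDiffOn ℝ ∞ A (Icc t₀ t₁))
    {ψ : Fin r → ℝ → StrongDual ℝ E} (hψ : ∀ a, ContDiffOn ℝ ∞ (ψ a) (Icc t₀ t₁))
    (hli : ∀ t ∈ Icc t₀ t₁, LinearIndependent ℝ (fun a => ψ a t))
    (h : ∀ η : ℝ → E, ContDiffOn ℝ ∞ η (Icc t₀ t₁) → η t₀ = 0 → η t₁ = 0 →
      (∀ t ∈ Icc t₀ t₁, ∀ a, ψ a t (η t) = 0) → ∫ t in t₀..t₁, A t (η t) = 0) :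
    ∃ lam : Fin r → ℝ → ℝ, ∀ t ∈ Icc t₀ t₁, A t = ∑ a, lam a t • ψ a t := by
  obtain ⟨J, hnonneg, hdef⟩ := exists_dual_euclidean E
  -- the Gram operator of the constraint covectors
  let Q : ℝ → (Fin r → ℝ) →L[ℝ] (Fin r → ℝ) := fun t =>
    ContinuousLinearMap.pi fun a => ∑ b, (ψ a t (J (ψ b t))) • ContinuousLinearMap.proj b
  have hQ : ∀ t c a, Q t c a = ψ a t (J (∑ b, c b • ψ b t)) := by
    intro t c a
    simp [Q, _root_.sum_apply, map_sum, mul_comm]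
  have hQs : ContDiffOn ℝ ∞ Q (Icc t₀ t₁) := by
    rw [contDiffOn_clm_apply]
    intro c
    rw [contDiffOn_pi]
    intro a
    simp only [hQ]
    exact (hψ a).clm_apply (J.contDiff.comp_contDiffOn
      (ContDiffOn.sum fun b _ => (hψ b).const_smul (c b)))
  have hQinj : ∀ t ∈ Icc t₀ t₁, Function.Injective (Q t) := by
    intro t htt
    rw [injective_iff_map_eq_zero]
    intro c hc
    have h0 : ∀ a, ψ a t (J (∑ b, c b • ψ b t)) = 0 := fun a => by rw [← hQ, hc]; rfl
    have h1 : ∑ b, c b • ψ b t = 0 := by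
      apply hdef
      rw [_root_.sum_apply]
      exact Finset.sum_eq_zero fun a _ => by
        rw [_root_.smul_apply, h0, smul_zero]
    exact funext (Fintype.linearIndependent_iff.1 (hli t htt) c h1)
  have hQe : ∀ t ∈ Icc t₀ t₁, ∃ e : (Fin r → ℝ) ≃L[ℝ] (Fin r → ℝ), (e : _ →L[ℝ] _) = Q t :=
    fun t htt => ⟨(LinearEquiv.ofInjectiveEndo (Q t : _ →ₗ[ℝ] _)
      (hQinj t htt)).toContinuousLinearEquiv, by ext1 x; rfl⟩
  let c : ℝ → Fin r → ℝ := fun t => (Q t).inverse fun a => ψ a t (J (A t))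
  have hcs : ContDiffOn ℝ ∞ c (Icc t₀ t₁) := by
    refine ContDiffOn.clm_apply (fun t htt => ?_) (contDiffOn_pi.2 fun a => (hψ a).clm_apply
      (J.contDiff.comp_contDiffOn hA))
    obtain ⟨e, he⟩ := hQe t htt
    have := contDiffAt_map_inverse (𝕜 := ℝ) (n := ∞) e
    rw [he] at this
    exact this.comp_contDiffWithinAt t (hQs t htt)
  have hQc : ∀ t ∈ Icc t₀ t₁, ∀ a, Q t (c t) a = ψ a t (J (A t)) := by
    intro t htt a
    obtain ⟨e, he⟩ := hQe t htt
    simp [c, ← he]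
  -- the component of `A` orthogonal to the constraint covectors
  let B : ℝ → StrongDual ℝ E := fun t => A t - ∑ a, c t a • ψ a t
  have hBs : ContDiffOn ℝ ∞ B (Icc t₀ t₁) :=
    hA.sub (ContDiffOn.sum fun a _ => (contDiffOn_pi.1 hcs a).smul (hψ a))
  have hBψ : ∀ t ∈ Icc t₀ t₁, ∀ a, ψ a t (J (B t)) = 0 := by
    intro t htt a
    have : ψ a t (J (B t)) = ψ a t (J (A t)) - ψ a t (J (∑ b, c t b • ψ b t)) := by
      simp only [B, map_sub]
    rw [this, ← hQ, hQc t htt, sub_self]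
  have hAB : ∀ t ∈ Icc t₀ t₁, A t (J (B t)) = B t (J (B t)) := by
    intro t htt
    have : B t (J (B t)) = A t (J (B t)) - ∑ a, c t a * ψ a t (J (B t)) := by
      simp [B, _root_.sum_apply]
    rw [this]
    simp [hBψ t htt]
  -- `J B` satisfies the constraints, and the factor `f` makes it vanish at the end points
  let f : ℝ → ℝ := fun t => (t - t₀) * (t₁ - t)
  have hfs : ContDiff ℝ ∞ f := by fun_prop
  have hint : ∫ t in t₀..t₁, f t * B t (J (B t)) = 0 := by
    have := h (fun t => f t • J (B t))
      (hfs.contDiffOn.smul (J.contDiff.comp_contDiffOn hBs)) (by simp [f]) (by simp [f])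
      (fun t htt a => by simp [hBψ t htt a])
    rw [← this]
    refine intervalIntegral.integral_congr fun t htt => ?_
    rw [uIcc_of_le ht.le] at htt
    simp [hAB t htt]
  have hcont : ContinuousOn (fun t => f t * B t (J (B t))) (Icc t₀ t₁) :=
    hfs.continuous.continuousOn.mul (hBs.continuousOn.clm_apply
      (J.continuous.comp_continuousOn hBs.continuousOn))
  have hnn : ∀ t ∈ Icc t₀ t₁, 0 ≤ f t * B t (J (B t)) := fun t htt =>
    mul_nonneg (mul_nonneg (sub_nonneg.2 htt.1) (sub_nonneg.2 htt.2)) (hnonneg _)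
  have hBzero : ∀ t ∈ Ioo t₀ t₁, B t = 0 := by
    intro t htt
    by_contra hne
    have hpos : 0 < f t * B t (J (B t)) :=
      mul_pos (mul_pos (sub_pos.2 htt.1) (sub_pos.2 htt.2))
        (lt_of_le_of_ne (hnonneg _) fun h0 => hne (hdef _ h0.symm))
    exact (intervalIntegral.integral_pos ht hcont (fun x hx => hnn x (Ioc_subset_Icc_self hx))
      ⟨t, Ioo_subset_Icc_self htt, hpos⟩).ne' hint
  have hBzero' : ∀ t ∈ Icc t₀ t₁, B t = 0 := by
    have : EqOn B 0 (Icc t₀ t₁) := by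
      have hcl : Icc t₀ t₁ ⊆ closure (Ioo t₀ t₁) := by rw [closure_Ioo ht.ne]
      exact EqOn.of_subset_closure (s := Ioo t₀ t₁) hBzero hBs.continuousOn continuousOn_const
        Ioo_subset_Icc_self hcl
    exact this
  exact ⟨fun a t => c t a, fun t htt => sub_eq_zero.1 (hBzero' t htt)⟩

end Constraints

/-! ### The logarithmic derivative and the Maurer–Cartan equation -/

section LogDerivative

variable {E : Type*} [NormedAddCommGroup E] [NormedSpace ℝ E]
  {H : Type*} [TopologicalSpace H] {I : ModelWithCorners ℝ E H}
  {S : Type*} [TopologicalSpace S] [ChartedSpace H S] [Group S]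
  {F : Type*} [NormedAddCommGroup F] [NormedSpace ℝ F]

/-- The left logarithmic derivative `V⁻¹ dV` of a map `V` into a Lie group, at `q` within `U`, read
in the chart at the identity: the derivative at `q` of `q' ↦ V(q)⁻¹ V(q')`. Its values lie in the
model space `E`, which is the underlying space of the Lie algebra. -/
noncomputable def leftLog (I : ModelWithCorners ℝ E H) (V : F → S) (U : Set F) (q : F) :
    F →L[ℝ] E :=
  fderivWithin ℝ (fun q' => extChartAt I (1 : S) ((V q)⁻¹ * V q')) U q

/-- The multiplication of the group, read in the chart at the identity. -/
noncomputable def chartMul (I : ModelWithCorners ℝ E H) (S : Type*) [TopologicalSpace S]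
    [ChartedSpace H S] [Group S]
    (x y : E) : E :=
  extChartAt I (1 : S) ((extChartAt I (1 : S)).symm x * (extChartAt I (1 : S)).symm y)

/-- The left trivialization of the tangent bundle, read in the chart at the identity: `leftTriv x`
sends `ξ` to the value at `x` of the left-invariant vector field through `ξ`. -/
noncomputable def leftTriv (I : ModelWithCorners ℝ E H) (S : Type*) [TopologicalSpace S]
    [ChartedSpace H S] [Group S]
    (x : E) : E →L[ℝ] E :=
  fderiv ℝ (chartMul I S x) (extChartAt I (1 : S) 1)

variable [LieGroup I ∞ S]

lemma contDiffWithinAt_chart_translate {V : F → S} {U : Set F} {q : F} {n : ℕ∞ω} (hn : n ≤ ∞)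
    (hV : ContMDiffWithinAt 𝓘(ℝ, F) I n V U q) (g : S)
    (hg : g⁻¹ * V q ∈ (chartAt H (1 : S)).source) :
    ContDiffWithinAt ℝ n (fun q' => extChartAt I (1 : S) (g⁻¹ * V q')) U q := by
  rw [← contMDiffWithinAt_iff_contDiffWithinAt]
  have : IsManifold I ∞ S := inferInstance
  have h1 : ContMDiffAt I 𝓘(ℝ, E) n (extChartAt I (1 : S)) (g⁻¹ * V q) :=
    (contMDiffAt_extChartAt' (n := ∞) hg).of_le hn
  have h2 : ContMDiffWithinAt 𝓘(ℝ, F) I n (fun q' => g⁻¹ * V q') U q :=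
    ((contMDiff_mul_left (I := I) (n := ∞) (a := g⁻¹)).of_le hn).contMDiffAt.comp_contMDiffWithinAt
      q hV
  exact h1.comp_contMDiffWithinAt q h2

lemma hasFDerivWithinAt_leftLog {V : F → S} {U : Set F} {q : F}
    (hV : ContMDiffWithinAt 𝓘(ℝ, F) I 1 V U q) :
    HasFDerivWithinAt (fun q' => extChartAt I (1 : S) ((V q)⁻¹ * V q')) (leftLog I V U q) U q := by
  have hone : (V q)⁻¹ * V q ∈ (chartAt H (1 : S)).source := by
    rw [inv_mul_cancel]; exact mem_chart_source H 1
  exact ((contDiffWithinAt_chart_translate (by exact_mod_cast le_top) hV (V q)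
      hone).differentiableWithinAt one_ne_zero).hasFDerivWithinAt

variable [I.Boundaryless]

lemma contDiffAt_chartMul {x : E} (hx : x ∈ (extChartAt I (1 : S)).target) :
    ContDiffAt ℝ ∞ (Function.uncurry (chartMul I S)) (x, extChartAt I (1 : S) 1) := by
  rw [← contMDiffAt_iff_contDiffAt]
  have : IsManifold I ∞ S := inferInstance
  have hsymm : ∀ y ∈ (extChartAt I (1 : S)).target,
      ContMDiffAt 𝓘(ℝ, E) I ∞ (extChartAt I (1 : S)).symm y := fun y hy =>
    (contMDiffOn_extChartAt_symm (n := ∞) (1 : S)).contMDiffAt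
      ((isOpen_extChartAt_target (I := I) (1 : S)).mem_nhds hy)
  have h1 : ContMDiffAt 𝓘(ℝ, E × E) I ∞ (fun p : E × E => (extChartAt I (1 : S)).symm p.1)
      (x, extChartAt I (1 : S) 1) :=
    ContMDiffAt.comp (x, extChartAt I (1 : S) 1) (g := (extChartAt I (1 : S)).symm) (hsymm x hx)
      contDiffAt_fst.contMDiffAt
  have h2 : ContMDiffAt 𝓘(ℝ, E × E) I ∞ (fun p : E × E => (extChartAt I (1 : S)).symm p.2)
      (x, extChartAt I (1 : S) 1) :=
    ContMDiffAt.comp (x, extChartAt I (1 : S) 1) (g := (extChartAt I (1 : S)).symm)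
      (hsymm _ (mem_extChartAt_target 1))
      contDiffAt_snd.contMDiffAt
  have h3 := h1.mul h2
  have hs : (extChartAt I (1 : S)).symm x * (extChartAt I (1 : S)).symm (extChartAt I (1 : S) 1) ∈
      (chartAt H (1 : S)).source := by
    rw [extChartAt_to_inv, mul_one, ← extChartAt_source I]
    exact (extChartAt I (1 : S)).map_target hx
  exact ContMDiffAt.comp (x, extChartAt I (1 : S) 1)
    (contMDiffAt_extChartAt' (I := I) (n := ∞) hs) h3

lemma contDiffAt_leftTriv :
    ContDiffAt ℝ ∞ (leftTriv I S) (extChartAt I (1 : S) 1) :=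
  ContDiffAt.fderiv (contDiffAt_chartMul (mem_extChartAt_target 1)) contDiffAt_const (by simp)

omit [LieGroup I ∞ S] in
lemma leftTriv_one : leftTriv I S (extChartAt I (1 : S) 1) = ContinuousLinearMap.id ℝ E := by
  have h : chartMul I S (extChartAt I (1 : S) 1) =ᶠ[𝓝 (extChartAt I (1 : S) 1)] id := by
    filter_upwards [extChartAt_target_mem_nhds (I := I) (1 : S)] with y hy
    rw [chartMul, extChartAt_to_inv, one_mul, (extChartAt I (1 : S)).right_inv hy, id]
  rw [leftTriv, h.fderiv_eq, fderiv_id]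

omit [I.Boundaryless] in
/-- The derivative of a map into the group is the left translate of its logarithmic derivative. -/
lemma mfderivWithin_eq_mulInvariantVectorField {V : F → S} {U : Set F} {q : F}
    (hV : ContMDiffWithinAt 𝓘(ℝ, F) I 1 V U q) (hU : UniqueDiffWithinAt ℝ U q) (w : F) :
    (mfderivWithin 𝓘(ℝ, F) I V U q w : TangentSpace I (V q)) =
      mulInvariantVectorField (I := I) (G := S) (leftLog I V U q w) (V q) := by
  set W : F → S := fun q' => (V q)⁻¹ * V q' with hW
  have hWq : W q = 1 := by simp [hW]
  have hWs : ContMDiffWithinAt 𝓘(ℝ, F) I 1 W U q :=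
    ((contMDiff_mul_left (I := I) (n := ∞) (a := (V q)⁻¹)).of_le
      (by exact_mod_cast le_top)).contMDiffAt.comp_contMDiffWithinAt q hV
  have hWd := hWs.mdifferentiableWithinAt one_ne_zero
  have hlog : (mfderivWithin 𝓘(ℝ, F) I W U q : F →L[ℝ] E) = leftLog I V U q := by
    rw [hWd.mfderivWithin, leftLog]
    simp only [writtenInExtChartAt, hWq, mfld_simps]
    rfl
  have hm : MDifferentiableAt I I (fun x => V q * x) (W q) :=
    (contMDiff_mul_left (I := I) (n := ∞) (a := V q)).mdifferentiable (by simp) _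
  have hVW : (fun x => V q * x) ∘ W = V := by ext; simp [hW]
  have hcomp : (mfderivWithin 𝓘(ℝ, F) I ((fun x => V q * x) ∘ W) U q : F →L[ℝ] E) =
      (mfderiv I I (fun x => V q * x) (W q) : E →L[ℝ] E).comp
        (mfderivWithin 𝓘(ℝ, F) I W U q : F →L[ℝ] E) :=
    mfderiv_comp_mfderivWithin (I := 𝓘(ℝ, F)) (I' := I) (I'' := I) q hm hWd
      hU.uniqueMDiffWithinAt
  rw [hVW, hlog, hWq] at hcomp
  exact congrArg (fun T : F →L[ℝ] E => T w) hcomp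

/-- In a left translate of the chart at the identity, the derivative of a map into the group is
the left trivialization applied to its logarithmic derivative. -/
lemma fderivWithin_chart_eq {V : F → S} {U : Set F} {q : F}
    (hV : ContMDiffWithinAt 𝓘(ℝ, F) I 1 V U q) (hU : UniqueDiffWithinAt ℝ U q) (g : S)
    (hg : g⁻¹ * V q ∈ (chartAt H (1 : S)).source) :
    fderivWithin ℝ (fun q' => extChartAt I (1 : S) (g⁻¹ * V q')) U q =
      (leftTriv I S (extChartAt I (1 : S) (g⁻¹ * V q))).comp (leftLog I V U q) := by
  set φ := extChartAt I (1 : S) with hφ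
  have hg' : g⁻¹ * V q ∈ φ.source := by rwa [hφ, extChartAt_source]
  have hone : (V q)⁻¹ * V q ∈ (chartAt H (1 : S)).source := by
    rw [inv_mul_cancel]; exact mem_chart_source H 1
  have hone' : (V q)⁻¹ * V q ∈ φ.source := by rwa [hφ, extChartAt_source]
  have h1 : HasFDerivWithinAt (fun q' => φ ((V q)⁻¹ * V q')) (leftLog I V U q) U q :=
    hasFDerivWithinAt_leftLog hV
  have h2 : HasFDerivAt (chartMul I S (φ (g⁻¹ * V q))) (leftTriv I S (φ (g⁻¹ * V q)))
      (φ ((V q)⁻¹ * V q)) := by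
    have := contDiffAt_chartMul (I := I) (S := S) (φ.map_source hg')
    rw [inv_mul_cancel]
    exact ((this.comp (φ 1) (contDiffAt_const.prodMk contDiffAt_id)).differentiableAt
      (by simp)).hasFDerivAt
  have h3 := h2.comp_hasFDerivWithinAt q h1
  refine HasFDerivWithinAt.fderivWithin (h3.congr_of_eventuallyEq ?_ ?_) hU
  · have hc : ContinuousWithinAt (fun q' => (V q)⁻¹ * V q') U q :=
      (contMDiff_mul_left (I := I) (n := ∞)
        (a := (V q)⁻¹)).continuous.continuousAt.comp_continuousWithinAt hV.continuousWithinAt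
    filter_upwards [hc.preimage_mem_nhdsWithin ((isOpen_extChartAt_source (I := I)
      (1 : S)).mem_nhds hone')] with q' hq'
    simp only [Function.comp, chartMul, ← hφ]
    rw [φ.left_inv hg', φ.left_inv hq']
    group
  · simp only [Function.comp, chartMul, ← hφ]
    rw [φ.left_inv hg', φ.left_inv hone']
    group

/-- `fderivWithin_chart_eq` near a point, in the left translate of the chart which is centred
there. -/
lemma eventually_fderivWithin_chart_eq {V : F → S} {U : Set F} {p : F} (hp : p ∈ U)
    (hV : ContMDiffOn 𝓘(ℝ, F) I ∞ V U) (hU : UniqueDiffOn ℝ U) :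
    ∀ᶠ q in 𝓝[U] p, fderivWithin ℝ (fun q' => extChartAt I (1 : S) ((V p)⁻¹ * V q')) U q =
      (leftTriv I S (extChartAt I (1 : S) ((V p)⁻¹ * V q))).comp (leftLog I V U q) := by
  have hc : ContinuousWithinAt (fun q' => (V p)⁻¹ * V q') U p :=
    (contMDiff_mul_left (I := I) (n := ∞)
      (a := (V p)⁻¹)).continuous.continuousAt.comp_continuousWithinAt (hV.continuousOn p hp)
  have hone : (V p)⁻¹ * V p ∈ (chartAt H (1 : S)).source := by
    rw [inv_mul_cancel]; exact mem_chart_source H 1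
  filter_upwards [hc.preimage_mem_nhdsWithin ((chartAt H (1 : S)).open_source.mem_nhds hone),
    self_mem_nhdsWithin] with q hq hqU
  exact fderivWithin_chart_eq ((hV q hqU).of_le (by exact_mod_cast le_top)) (hU q hqU) _ hq

/-- The logarithmic derivative of a smooth map is smooth: near a point it is obtained from the
derivative in a chart by the inverse of the left trivialization. -/
lemma contDiffOn_leftLog [FiniteDimensional ℝ E] {V : F → S} {U : Set F}
    (hV : ContMDiffOn 𝓘(ℝ, F) I ∞ V U) (hU : UniqueDiffOn ℝ U) :
    ContDiffOn ℝ ∞ (leftLog I V U) U := by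
  intro p hp
  set v : F → E := fun q => extChartAt I (1 : S) ((V p)⁻¹ * V q) with hv
  have hone : (V p)⁻¹ * V p ∈ (chartAt H (1 : S)).source := by
    rw [inv_mul_cancel]; exact mem_chart_source H 1
  have hvp : v p = extChartAt I (1 : S) 1 := by simp [hv]
  have hvs : ContDiffWithinAt ℝ ∞ v U p :=
    contDiffWithinAt_chart_translate le_rfl (hV p hp) (V p) hone
  have hR : ContDiffAt ℝ ∞ (leftTriv I S) (v p) := by rw [hvp]; exact contDiffAt_leftTriv
  have hRp : leftTriv I S (v p) = (ContinuousLinearEquiv.refl ℝ E : E →L[ℝ] E) := by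
    rw [hvp, leftTriv_one]; rfl
  have hRv : ContDiffWithinAt ℝ ∞ (fun q => leftTriv I S (v q)) U p :=
    hR.comp_contDiffWithinAt p hvs
  have hinv : ContDiffWithinAt ℝ ∞ (fun q => (leftTriv I S (v q)).inverse) U p := by
    have := contDiffAt_map_inverse (𝕜 := ℝ) (n := ∞) (ContinuousLinearEquiv.refl ℝ E)
    rw [← hRp] at this
    exact this.comp_contDiffWithinAt p hRv
  have hinvertible : ∀ᶠ q in 𝓝[U] p, (leftTriv I S (v q)).IsInvertible := by
    have : {T : E →L[ℝ] E | T.IsInvertible} ∈ 𝓝 (leftTriv I S (v p)) := by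
      rw [hRp]
      exact ContinuousLinearEquiv.nhds _
    exact hRv.continuousWithinAt.preimage_mem_nhdsWithin this
  have heq : ∀ᶠ q in 𝓝[U] p, leftLog I V U q =
      ((leftTriv I S (v q)).inverse).comp (fderivWithin ℝ v U q) := by
    filter_upwards [hinvertible, eventually_fderivWithin_chart_eq hp hV hU] with q ⟨e, he⟩ hq
    have hcancel := congrArg (fun T : E →L[ℝ] E => T.comp (leftLog I V U q))
      (ContinuousLinearMap.IsInvertible.inverse_comp_self ⟨e, he⟩)
    rw [hq, ← ContinuousLinearMap.comp_assoc]
    exact hcancel.symm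
  refine ContDiffWithinAt.congr_of_eventuallyEq ?_ heq (heq.self_of_nhdsWithin hp)
  exact hinv.clm_comp (hvs.fderivWithin_right hU (by simp) hp)

/-- The bracket of the Lie algebra, in terms of the derivative at the identity of the left
trivialization. -/
lemma bracket_eq_fderiv_leftTriv [FiniteDimensional ℝ E] (ξ η : GroupLieAlgebra I S) :
    (⁅ξ, η⁆ : GroupLieAlgebra I S) =
      fderiv ℝ (leftTriv I S) (extChartAt I (1 : S) 1) ξ η
        - fderiv ℝ (leftTriv I S) (extChartAt I (1 : S) 1) η ξ := by
  -- in the chart, the left-invariant vector field through `ζ` is `x ↦ leftTriv x ζ`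
  have hpull : ∀ ζ : GroupLieAlgebra I S,
      VectorField.mpullbackWithin 𝓘(ℝ, E) I (extChartAt I (1 : S)).symm
        (mulInvariantVectorField ζ) (range I) =ᶠ[𝓝 (extChartAt I (1 : S) 1)]
        fun x => leftTriv I S x ζ := by
    intro ζ
    filter_upwards [extChartAt_target_mem_nhds (I := I) (1 : S)] with x hx
    set φ := extChartAt I (1 : S) with hφ
    have hsm : ContMDiffWithinAt 𝓘(ℝ, E) I 1 φ.symm (range I) x :=
      ((contMDiffOn_extChartAt_symm (I := I) (n := ∞) (1 : S)).contMDiffAt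
        ((isOpen_extChartAt_target (I := I) (1 : S)).mem_nhds hx)).contMDiffWithinAt.of_le
          (by exact_mod_cast le_top)
    have hud : UniqueDiffWithinAt ℝ (range I) x := by
      rw [I.range_eq_univ]; exact uniqueDiffWithinAt_univ
    have hsrc : (1 : S)⁻¹ * φ.symm x ∈ (chartAt H (1 : S)).source := by
      rw [inv_one, one_mul, ← extChartAt_source I]; exact φ.map_target hx
    have h1 := fderivWithin_chart_eq hsm hud 1 hsrc
    have h2 : fderivWithin ℝ (fun q' => φ ((1 : S)⁻¹ * φ.symm q')) (range I) x =
        ContinuousLinearMap.id ℝ E := by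
      have : (fun q' => φ ((1 : S)⁻¹ * φ.symm q')) =ᶠ[𝓝 x] id := by
        filter_upwards [(isOpen_extChartAt_target (I := I) (1 : S)).mem_nhds hx] with y hy
        rw [inv_one, one_mul, φ.right_inv hy, id]
      rw [this.filter_mono nhdsWithin_le_nhds |>.fderivWithin_eq this.self_of_nhds,
        fderivWithin_id hud]
    rw [← hφ, h2, inv_one, one_mul, φ.right_inv hx] at h1
    have h3 : leftLog I φ.symm (range I) x (leftTriv I S x ζ) = ζ := by
      have h4 : (leftLog I φ.symm (range I) x : E →ₗ[ℝ] E) * (leftTriv I S x : E →ₗ[ℝ] E) =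
          1 := by
        rw [mul_eq_one_comm]
        ext y
        exact (congrArg (fun T : E →L[ℝ] E => T y) h1).symm
      exact LinearMap.congr_fun h4 ζ
    have h5 := mfderivWithin_eq_mulInvariantVectorField hsm hud (leftTriv I S x ζ)
    rw [h3] at h5
    exact ((isInvertible_mfderivWithin_extChartAt_symm hx).inverse_apply_eq).2 h5.symm
  have hd : HasFDerivAt (leftTriv I S) (fderiv ℝ (leftTriv I S) (extChartAt I (1 : S) 1))
      (extChartAt I (1 : S) 1) := (contDiffAt_leftTriv.differentiableAt (by simp)).hasFDerivAt
  have hdζ : ∀ ζ : E, fderiv ℝ (fun x => leftTriv I S x ζ) (extChartAt I (1 : S) 1) =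
      (fderiv ℝ (leftTriv I S) (extChartAt I (1 : S) 1)).flip ζ := by
    intro ζ
    rw [(hd.clm_apply (hasFDerivAt_const ζ _)).fderiv]
    ext w
    simp
  have key : ∀ A B : E → E, (A =ᶠ[𝓝 (extChartAt I (1 : S) 1)] fun x => leftTriv I S x ξ) →
      (B =ᶠ[𝓝 (extChartAt I (1 : S) 1)] fun x => leftTriv I S x η) →
      VectorField.lieBracketWithin ℝ A B univ (extChartAt I (1 : S) 1) =
        fderiv ℝ (leftTriv I S) (extChartAt I (1 : S) 1) ξ η
          - fderiv ℝ (leftTriv I S) (extChartAt I (1 : S) 1) η ξ := by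
    intro A B hA hB
    rw [VectorField.lieBracketWithin_univ, hA.lieBracket_vectorField_eq hB, VectorField.lieBracket,
      hdζ ξ, hdζ η, leftTriv_one]
    rfl
  rw [GroupLieAlgebra.bracket_def, ← VectorField.mlieBracketWithin_univ,
    VectorField.mlieBracketWithin_apply]
  refine (isInvertible_mfderiv_extChartAt (mem_extChartAt_source (1 : S))).inverse_apply_eq.2 ?_
  rw [mfderiv_extChartAt_self, preimage_univ, univ_inter, I.range_eq_univ]
  rw [I.range_eq_univ] at hpull
  exact key _ _ (hpull ξ) (hpull η)

/-- The Maurer–Cartan equation for the left logarithmic derivative `ω`,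
`dω(w₁, w₂) = [ω(w₂), ω(w₁)]`. It also holds at boundary points which are limits of interior
points. -/
lemma maurerCartan [FiniteDimensional ℝ E] {V : F → S} {U : Set F} {p : F} (hp : p ∈ U)
    (hpi : p ∈ closure (interior U))
    (hV : ContMDiffOn 𝓘(ℝ, F) I ∞ V U) (hU : UniqueDiffOn ℝ U) (w₁ w₂ : F)
    {ξ η : GroupLieAlgebra I S} (hξ : leftLog I V U p w₁ = ξ) (hη : leftLog I V U p w₂ = η) :
    fderivWithin ℝ (leftLog I V U) U p w₁ w₂ - fderivWithin ℝ (leftLog I V U) U p w₂ w₁ =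
      ⁅η, ξ⁆ := by
  set v : F → E := fun q => extChartAt I (1 : S) ((V p)⁻¹ * V q) with hv
  have hone : (V p)⁻¹ * V p ∈ (chartAt H (1 : S)).source := by
    rw [inv_mul_cancel]; exact mem_chart_source H 1
  have hvp : v p = extChartAt I (1 : S) 1 := by simp [hv]
  have hvs : ContDiffWithinAt ℝ ∞ v U p :=
    contDiffWithinAt_chart_translate le_rfl (hV p hp) (V p) hone
  have hvd : HasFDerivWithinAt v (leftLog I V U p) U p :=
    (hvs.differentiableWithinAt (by simp)).hasFDerivWithinAt
  have hR : HasFDerivAt (leftTriv I S) (fderiv ℝ (leftTriv I S) (extChartAt I (1 : S) 1))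
      (v p) := by
    rw [hvp]; exact (contDiffAt_leftTriv.differentiableAt (by simp)).hasFDerivAt
  have hRv := hR.comp_hasFDerivWithinAt p hvd
  have hω : HasFDerivWithinAt (leftLog I V U) (fderivWithin ℝ (leftLog I V U) U p) U p :=
    ((contDiffOn_leftLog hV hU).differentiableOn (by simp) p hp).hasFDerivWithinAt
  -- differentiate `dv = R(v) ω`, where `R` is the left trivialization, and use `R = id` at the
  -- identity and the symmetry of the second derivative of `v`
  have heq := eventually_fderivWithin_chart_eq hp hV hU
  have hD := (hRv.clm_comp hω).congr_of_eventuallyEq heq (heq.self_of_nhdsWithin hp)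
  have hsymm := hvs.isSymmSndFDerivWithinAt (by simpa using ENat.LEInfty.out) hU hpi hp
  have h12 := hsymm w₁ w₂
  rw [hD.fderivWithin (hU p hp)] at h12
  rw [bracket_eq_fderiv_leftTriv]
  simp only [_root_.add_apply, ContinuousLinearMap.comp_apply, ContinuousLinearMap.compL_apply,
    ContinuousLinearMap.flip_apply, Function.comp_apply, hvp, leftTriv_one,
    ContinuousLinearMap.id_apply] at h12
  rw [← hξ, ← hη, sub_eq_sub_iff_add_eq_add]
  rw [h12, add_comm]

end LogDerivative

/-! ### Left translation of velocities, Lagrangian, constraints and parameter -/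

section Reduction

variable {E : Type*} [NormedAddCommGroup E] [NormedSpace ℝ E]
  {H : Type*} [TopologicalSpace H] {I : ModelWithCorners ℝ E H}
  {S : Type*} [TopologicalSpace S] [ChartedSpace H S] [Group S] [LieGroup I ∞ S]
  {X : Type*} [NormedAddCommGroup X] [NormedSpace ℝ X] {r : ℕ}
  {F : Type*} [NormedAddCommGroup F] [NormedSpace ℝ F]
  {F' : Type*} [NormedAddCommGroup F'] [NormedSpace ℝ F']
  {ρ : S →* (X →L[ℝ] X)} {γ₀ : StrongDual ℝ X}

/-- The chain rule for the logarithmic derivative. -/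
lemma leftLog_comp {V : F → S} {U : Set F} {c : F' → F} {U' : Set F'} {x : F'} {c' : F' →L[ℝ] F}
    (hV : ContMDiffWithinAt 𝓘(ℝ, F) I 1 V U (c x)) (hc : HasFDerivWithinAt c c' U' x)
    (hU : UniqueDiffWithinAt ℝ U' x) (hm : MapsTo c U' U) :
    leftLog I (fun y => V (c y)) U' x = (leftLog I V U (c x)).comp c' :=
  ((hasFDerivWithinAt_leftLog hV).comp x hc hm).fderivWithin hU

omit [LieGroup I ∞ S] in
lemma leftLog_congr {V W : F → S} {U : Set F} {q : F} (h : EqOn V W U) (hq : q ∈ U) :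
    leftLog I V U q = leftLog I W U q :=
  fderivWithin_congr (fun x hx => by simp only [h hx, h hq]) (by simp only [h hq])

lemma mulInvariantVectorField_injective (g : S) :
    Function.Injective fun ξ : GroupLieAlgebra I S => mulInvariantVectorField ξ g := by
  intro ξ η h
  have hid : (fun x => g⁻¹ * x) ∘ (fun x => g * x) = (id : S → S) := by ext; simp
  have hd : ∀ a b : S, MDifferentiableAt I I (fun x => a * x) b := fun a b =>
    (contMDiff_mul_left (I := I) (n := ∞) (a := a)).mdifferentiable (by simp) b
  have hcomp := mfderiv_comp (I := I) (I' := I) (I'' := I) (1 : S) (hd g⁻¹ (g * 1)) (hd g 1)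
  rw [hid, mfderiv_id] at hcomp
  have h1 : ∀ ζ : GroupLieAlgebra I S, mfderiv I I (fun x => g⁻¹ * x) (g * 1)
      (mulInvariantVectorField ζ g) = ζ := fun ζ =>
    (congrArg (fun T : E →L[ℝ] E => T ζ) hcomp).symm
  rw [← h1 ξ, ← h1 η]
  exact congrArg (fun v : E => (mfderiv I I (fun x => g⁻¹ * x) (g * 1) : E →L[ℝ] E) v) h

lemma mulInvariantVectorField_surjective (g : S) :
    Function.Surjective fun ξ : GroupLieAlgebra I S => mulInvariantVectorField ξ g := by
  intro v
  have hid : (fun x => g * x) ∘ (fun x => g⁻¹ * x) = (id : S → S) := by ext; simp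
  have hd : ∀ a b : S, MDifferentiableAt I I (fun x => a * x) b := fun a b =>
    (contMDiff_mul_left (I := I) (n := ∞) (a := a)).mdifferentiable (by simp) b
  have hcomp : (mfderiv I I ((fun x => g * x) ∘ (fun x => g⁻¹ * x)) g : E →L[ℝ] E) =
      (mfderiv I I (fun x => g * x) (g⁻¹ * g) : E →L[ℝ] E).comp
        (mfderiv I I (fun x => g⁻¹ * x) g : E →L[ℝ] E) :=
    mfderiv_comp (I := I) (I' := I) (I'' := I) g (hd g (g⁻¹ * g)) (hd g⁻¹ g)
  rw [hid, mfderiv_id, inv_mul_cancel] at hcomp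
  exact ⟨(mfderiv I I (fun x => g⁻¹ * x) g : E →L[ℝ] E) v,
    (congrArg (fun T : E →L[ℝ] E => T v) hcomp).symm⟩

omit [ChartedSpace H S] [TopologicalSpace S] in
lemma dualAct_dualAct_inv (g : S) : dualAct ρ g (dualAct ρ g⁻¹ γ₀) = γ₀ := by
  ext x
  simp only [dualAct, inv_inv, ContinuousLinearMap.comp_apply]
  rw [← mul_apply_eq_comp, ← map_mul]
  simp

/-- The Lagrangian along a tangent vector is the reduced Lagrangian of its left translate. -/
lemma lagrangian_eq_reducedLagrangian {L₀ : TangentBundle I S → ℝ}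
    {L : TangentBundle I S → StrongDual ℝ X → ℝ} (hL : RecoversLagrangian ρ γ₀ L₀ L) (g : S)
    (ξ : GroupLieAlgebra I S) :
    L₀ ⟨g, mulInvariantVectorField ξ g⟩ = reducedLagrangian L ξ (dualAct ρ g⁻¹ γ₀) := by
  -- `g * 1` and `g` have the same tangent space, `E`, but only propositionally the same base point
  have hbase : ∀ (a b : S) (v : E), a = b →
      (⟨a, v⟩ : TangentBundle I S) = (⟨b, v⟩ : TangentBundle I S) := by
    rintro a _ v rfl; rfl
  rw [reducedLagrangian, ← hL.invariant g, dualAct_dualAct_inv, hL.extends_base]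
  exact congrArg L₀ (hbase _ _ _ (mul_one g).symm)

/-- The constraint forms on a tangent vector are the reduced forms on its left translate. -/
lemma form_eq_reducedForm {D : (s : S) → Submodule ℝ (TangentSpace I s)}
    {Ψ₀ : Fin r → (s : S) → TangentSpace I s →L[ℝ] ℝ}
    {Ψ : Fin r → (s : S) → StrongDual ℝ X → TangentSpace I s →L[ℝ] ℝ}
    (hΨ : RecoversConstraints ρ γ₀ D Ψ₀ Ψ) (a : Fin r) (g : S) (ξ : GroupLieAlgebra I S) :
    Ψ₀ a g (mulInvariantVectorField ξ g) = reducedForm Ψ a (dualAct ρ g⁻¹ γ₀) ξ := by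
  have hbase : ∀ (b c : S) (v : E), b = c →
      (Ψ₀ a b : E →L[ℝ] ℝ) v = (Ψ₀ a c : E →L[ℝ] ℝ) v := by
    rintro b _ v rfl; rfl
  rw [reducedForm, ← hΨ.invariant a g, dualAct_dualAct_inv, hΨ.extends_base]
  exact hbase _ _ _ (mul_one g).symm

lemma mem_distribution_iff {D : (s : S) → Submodule ℝ (TangentSpace I s)}
    {Ψ₀ : Fin r → (s : S) → TangentSpace I s →L[ℝ] ℝ}
    {Ψ : Fin r → (s : S) → StrongDual ℝ X → TangentSpace I s →L[ℝ] ℝ}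
    (hΨ : RecoversConstraints ρ γ₀ D Ψ₀ Ψ) (g : S) (ξ : GroupLieAlgebra I S) :
    mulInvariantVectorField ξ g ∈ D g ↔
      ∀ a, reducedForm Ψ a (dualAct ρ g⁻¹ γ₀) ξ = 0 := by
  simp only [hΨ.distribution, form_eq_reducedForm hΨ]

lemma linearIndependent_reducedForm {D : (s : S) → Submodule ℝ (TangentSpace I s)}
    {Ψ₀ : Fin r → (s : S) → TangentSpace I s →L[ℝ] ℝ}
    {Ψ : Fin r → (s : S) → StrongDual ℝ X → TangentSpace I s →L[ℝ] ℝ}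
    (hΨ : RecoversConstraints ρ γ₀ D Ψ₀ Ψ) (g : S)
    (h : LinearIndependent ℝ (fun a => Ψ₀ a g)) :
    LinearIndependent ℝ (fun a => reducedForm Ψ a (dualAct ρ g⁻¹ γ₀)) := by
  rw [Fintype.linearIndependent_iff] at h ⊢
  intro c hc
  refine h c ?_
  ext v
  obtain ⟨ξ, rfl⟩ := mulInvariantVectorField_surjective g v
  have := congrArg (fun T : StrongDual ℝ (GroupLieAlgebra I S) => T ξ) hc
  simp only [_root_.sum_apply, _root_.smul_apply, form_eq_reducedForm hΨ] at this ⊢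
  exact this

/-- The inclusion of the tangent space at the identity into the tangent bundle is smooth. -/
lemma contMDiff_mk_one :
    ContMDiff 𝓘(ℝ, E) I.tangent ∞ (fun ξ : E => (⟨1, ξ⟩ : TangentBundle I S)) := by
  intro ξ
  rw [Bundle.contMDiffAt_totalSpace]
  refine ⟨contMDiffAt_const, ?_⟩
  simp only [TangentBundle.trivializationAt_apply]
  exact (ContinuousLinearMap.contDiff _).contMDiff.contMDiffAt

lemma contDiff_of_contMDiff_prod {f : F × F' → ℝ}
    (h : ContMDiff (𝓘(ℝ, F).prod 𝓘(ℝ, F')) 𝓘(ℝ, ℝ) ∞ f) : ContDiff ℝ ∞ f := by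
  rwa [← modelWithCornersSelf_prod, chartedSpaceSelf_prod, contMDiff_iff_contDiff] at h

lemma contDiff_reducedLagrangian {L₀ : TangentBundle I S → ℝ}
    {L : TangentBundle I S → StrongDual ℝ X → ℝ} (hL : RecoversLagrangian ρ γ₀ L₀ L) :
    ContDiff ℝ ∞ (fun p : GroupLieAlgebra I S × StrongDual ℝ X => reducedLagrangian L p.1 p.2) := by
  have h : ContMDiff (𝓘(ℝ, E).prod 𝓘(ℝ, StrongDual ℝ X)) 𝓘(ℝ, ℝ) ∞
      (fun p : E × StrongDual ℝ X => reducedLagrangian L p.1 p.2) :=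
    hL.smooth.comp ((contMDiff_mk_one.comp contMDiff_fst).prodMk contMDiff_snd)
  exact contDiff_of_contMDiff_prod h

lemma contDiffOn_reducedForm [FiniteDimensional ℝ E]
    {D : (s : S) → Submodule ℝ (TangentSpace I s)}
    {Ψ₀ : Fin r → (s : S) → TangentSpace I s →L[ℝ] ℝ}
    {Ψ : Fin r → (s : S) → StrongDual ℝ X → TangentSpace I s →L[ℝ] ℝ}
    (hΨ : RecoversConstraints ρ γ₀ D Ψ₀ Ψ) (a : Fin r) {Γ : F → StrongDual ℝ X} {U : Set F}
    (hΓ : ContDiffOn ℝ ∞ Γ U) : ContDiffOn ℝ ∞ (fun t => reducedForm Ψ a (Γ t)) U := by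
  have h : ContMDiff (𝓘(ℝ, E).prod 𝓘(ℝ, StrongDual ℝ X)) 𝓘(ℝ, ℝ) ∞
      (fun p : E × StrongDual ℝ X => reducedForm Ψ a p.2 p.1) :=
    (hΨ.smooth a).comp ((contMDiff_mk_one.comp contMDiff_fst).prodMk contMDiff_snd)
  rw [contDiffOn_clm_apply]
  intro v
  exact (contDiff_of_contMDiff_prod h).comp_contDiffOn
    ((contDiffOn_const (c := (v : E))).prodMk hΓ)

variable [I.Boundaryless]

/-- The derivative of a representation along a map into the group. -/
lemma hasFDerivWithinAt_rep (hρ : ContMDiff I 𝓘(ℝ, X →L[ℝ] X) ∞ (fun s : S => ρ s))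
    {V : F → S} {U : Set F} {q : F} (hV : ContMDiffWithinAt 𝓘(ℝ, F) I 1 V U q) :
    HasFDerivWithinAt (fun q' => ρ (V q'))
      ((ContinuousLinearMap.compL ℝ X X X (ρ (V q))).comp
        ((algAct I ρ : E →L[ℝ] (X →L[ℝ] X)).comp (leftLog I V U q))) U q := by
  set φ := extChartAt I (1 : S) with hφ
  have hone : (V q)⁻¹ * V q ∈ φ.source := by
    rw [inv_mul_cancel]; exact mem_extChartAt_source 1
  have h1 : HasFDerivAt (fun x => ρ (φ.symm x)) (algAct I ρ : E →L[ℝ] (X →L[ℝ] X)) (φ 1) := by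
    have h0 : ∀ A : E →L[ℝ] (X →L[ℝ] X),
        HasFDerivWithinAt (fun x => ρ (φ.symm x)) A (range I) (φ 1) →
        HasFDerivAt (fun x => ρ (φ.symm x)) A (φ 1) := by
      intro A hA
      rwa [I.range_eq_univ, hasFDerivWithinAt_univ] at hA
    exact h0 _ (hρ.mdifferentiable (by simp) (1 : S)).hasMFDerivAt.2
  have h2 : HasFDerivAt (fun x => ρ (φ.symm x)) (algAct I ρ : E →L[ℝ] (X →L[ℝ] X))
      (φ ((V q)⁻¹ * V q)) := by rw [inv_mul_cancel]; exact h1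
  have h3 := (ContinuousLinearMap.compL ℝ X X X (ρ (V q))).hasFDerivAt.comp_hasFDerivWithinAt q
    (h2.comp_hasFDerivWithinAt q (hasFDerivWithinAt_leftLog hV))
  have hprod : ∀ q', (V q)⁻¹ * V q' ∈ φ.source →
      ρ (V q') = (ρ (V q)).comp (ρ (φ.symm (φ ((V q)⁻¹ * V q')))) := by
    intro q' hq'
    rw [φ.left_inv hq', map_mul]
    change _ = ρ (V q) * (ρ (V q)⁻¹ * ρ (V q'))
    rw [← mul_assoc, ← map_mul]
    simp
  refine h3.congr_of_eventuallyEq ?_ (hprod q hone)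
  have hc : ContinuousWithinAt (fun q' => (V q)⁻¹ * V q') U q :=
    (contMDiff_mul_left (I := I) (n := ∞)
      (a := (V q)⁻¹)).continuous.continuousAt.comp_continuousWithinAt hV.continuousWithinAt
  filter_upwards [hc.preimage_mem_nhdsWithin ((isOpen_extChartAt_source (I := I)
      (1 : S)).mem_nhds hone)] with q' hq'
  exact hprod q' hq'

/-- Along a map `V` into the group, the advected parameter `Γ = V⁻¹ γ₀` satisfies
`dΓ = -(V⁻¹ dV) Γ`. -/
lemma hasFDerivWithinAt_dualAct_inv (hρ : ContMDiff I 𝓘(ℝ, X →L[ℝ] X) ∞ (fun s : S => ρ s))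
    (γ₀ : StrongDual ℝ X)
    {V : F → S} {U : Set F} {q : F} (hV : ContMDiffWithinAt 𝓘(ℝ, F) I 1 V U q) :
    ∃ T : F →L[ℝ] StrongDual ℝ X, HasFDerivWithinAt (fun q' => dualAct ρ (V q')⁻¹ γ₀) T U q ∧
      ∀ w, T w = -(algDualAct (I := I) ρ (leftLog I V U q w) (dualAct ρ (V q)⁻¹ γ₀)) := by
  have h := (ContinuousLinearMap.compL ℝ X X ℝ γ₀).hasFDerivAt.comp_hasFDerivWithinAt q
    (hasFDerivWithinAt_rep hρ hV)
  refine ⟨_, h.congr_of_eventuallyEq (Eventually.of_forall fun q' => ?_) ?_, fun w => ?_⟩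
  · simp [dualAct]
  · simp [dualAct]
  · ext x
    simp [dualAct, algDualAct]
    rfl

omit [LieGroup I ∞ S] [I.Boundaryless] in
lemma contDiffOn_dualAct_inv (hρ : ContMDiff I 𝓘(ℝ, X →L[ℝ] X) ∞ (fun s : S => ρ s))
    (γ₀ : StrongDual ℝ X) {V : F → S} {U : Set F} (hV : ContMDiffOn 𝓘(ℝ, F) I ∞ V U) :
    ContDiffOn ℝ ∞ (fun q => dualAct ρ (V q)⁻¹ γ₀) U := by
  have h : ContDiffOn ℝ ∞ (fun q => ρ (V q)) U := by
    rw [← contMDiffOn_iff_contDiffOn]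
    exact hρ.comp_contMDiffOn hV
  have := (ContinuousLinearMap.compL ℝ X X ℝ γ₀).contDiff.comp_contDiffOn h
  refine this.congr fun q hq => ?_
  simp [dualAct]

end Reduction

/-! ### Deformations and the first variation -/

section FirstVariation

/-- The first variation of `∫ l(ξ, Γ) dt` is the integral of the linearized integrand. -/
lemma hasDerivAt_action {𝔤 Y : Type*} [NormedAddCommGroup 𝔤] [NormedSpace ℝ 𝔤]
    [NormedAddCommGroup Y] [NormedSpace ℝ Y] {l : 𝔤 → Y → ℝ}
    (hl : ContDiff ℝ ∞ (fun p : 𝔤 × Y => l p.1 p.2)) {t₀ t₁ δ : ℝ} (ht : t₀ < t₁) (hδ : 0 < δ)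
    {ξv : ℝ → ℝ → 𝔤} {Γv : ℝ → ℝ → Y} {dξ : ℝ → 𝔤} {dΓ : ℝ → Y} {ξ : ℝ → 𝔤} {Γ : ℝ → Y}
    (hξv : ContDiffOn ℝ ∞ (fun p : ℝ × ℝ => ξv p.1 p.2) (Ioo (-δ) δ ×ˢ Icc t₀ t₁))
    (hΓv : ContDiffOn ℝ ∞ (fun p : ℝ × ℝ => Γv p.1 p.2) (Ioo (-δ) δ ×ˢ Icc t₀ t₁))
    (hξ0 : ∀ t ∈ Icc t₀ t₁, ξv 0 t = ξ t) (hΓ0 : ∀ t ∈ Icc t₀ t₁, Γv 0 t = Γ t)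
    (hdξ : ∀ t ∈ Icc t₀ t₁, HasDerivAt (fun ε => ξv ε t) (dξ t) 0)
    (hdΓ : ∀ t ∈ Icc t₀ t₁, HasDerivAt (fun ε => Γv ε t) (dΓ t) 0) :
    HasDerivAt (fun ε => ∫ t in t₀..t₁, l (ξv ε t) (Γv ε t))
      (∫ t in t₀..t₁, (fderiv ℝ (fun ζ => l ζ (Γ t)) (ξ t) (dξ t)
        + fderiv ℝ (fun γ => l (ξ t) γ) (Γ t) (dΓ t))) 0 := by
  refine hasDerivAt_intervalIntegral_of_contDiffOn ht hδ
    (G := fun p => l (ξv p.1 p.2) (Γv p.1 p.2))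
    ((hl.comp_contDiffOn (hξv.prodMk hΓv)).of_le (by exact_mod_cast le_top)) fun t htt => ?_
  have hd : HasFDerivAt (fun p : 𝔤 × Y => l p.1 p.2)
      (fderiv ℝ (fun p : 𝔤 × Y => l p.1 p.2) (ξ t, Γ t)) (ξ t, Γ t) :=
    (hl.differentiable (by simp) _).hasFDerivAt
  have h1 : fderiv ℝ (fun ζ => l ζ (Γ t)) (ξ t) (dξ t) =
      fderiv ℝ (fun p : 𝔤 × Y => l p.1 p.2) (ξ t, Γ t) (dξ t, 0) := by
    have h := HasFDerivAt.comp (f := fun ζ => (ζ, Γ t)) (ξ t) hd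
      (hasFDerivAt_prodMk_left (ξ t) (Γ t))
    exact (congrArg (fun T : 𝔤 →L[ℝ] ℝ => T (dξ t)) h.fderiv).trans (by simp)
  have h2 : fderiv ℝ (fun γ => l (ξ t) γ) (Γ t) (dΓ t) =
      fderiv ℝ (fun p : 𝔤 × Y => l p.1 p.2) (ξ t, Γ t) (0, dΓ t) := by
    have h := HasFDerivAt.comp (f := fun γ => (ξ t, γ)) (Γ t) hd
      (hasFDerivAt_prodMk_right (ξ t) (Γ t))
    exact (congrArg (fun T : Y →L[ℝ] ℝ => T (dΓ t)) h.fderiv).trans (by simp)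
  rw [h1, h2, ← map_add, Prod.mk_add_mk, add_zero, zero_add]
  rw [← hξ0 t htt, ← hΓ0 t htt] at hd ⊢
  exact hd.comp_hasDerivAt (0 : ℝ) ((hdξ t htt).prodMk (hdΓ t htt))

end FirstVariation

section Variations

variable {E : Type*} [NormedAddCommGroup E] [NormedSpace ℝ E] [FiniteDimensional ℝ E]
  {H : Type*} [TopologicalSpace H] {I : ModelWithCorners ℝ E H} [I.Boundaryless]
  {S : Type*} [TopologicalSpace S] [ChartedSpace H S] [Group S] [LieGroup I ∞ S]
  {X : Type*} [NormedAddCommGroup X] [NormedSpace ℝ X]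
  {ρ : S →* (X →L[ℝ] X)} {γ₀ : StrongDual ℝ X} {t₀ t₁ δ : ℝ}

omit [FiniteDimensional ℝ E] [I.Boundaryless] in
lemma velocity_eq {s : ℝ → S} (ht : t₀ < t₁) (hs : ContMDiffOn 𝓘(ℝ, ℝ) I ∞ s (Icc t₀ t₁)) {t : ℝ}
    (htt : t ∈ Icc t₀ t₁) :
    velocity I t₀ t₁ s t =
      mulInvariantVectorField (I := I) (G := S) (leftLog I s (Icc t₀ t₁) t 1) (s t) :=
  mfderivWithin_eq_mulInvariantVectorField ((hs t htt).of_le (by exact_mod_cast le_top))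
    (uniqueDiffOn_Icc ht t htt) 1

omit [FiniteDimensional ℝ E] [I.Boundaryless] in
lemma variationField_eq {V : ℝ → ℝ → S} {t : ℝ}
    (hV : ContMDiffAt 𝓘(ℝ, ℝ) I 1 (fun ε => V ε t) 0) :
    variationField I V t = mulInvariantVectorField (I := I) (G := S)
      (leftLog I (fun ε => V ε t) univ 0 1) (V 0 t) := by
  rw [variationField, ← mfderivWithin_univ]
  exact mfderivWithin_eq_mulInvariantVectorField hV.contMDiffWithinAt uniqueDiffWithinAt_univ 1

/-- Left translation to the identity turns a deformation of a curve in the group into a deformation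
of its reduced curve, whose variation is the one admitted in the reduced principle. -/
lemma exists_reduced_deformation (hρ : ContMDiff I 𝓘(ℝ, X →L[ℝ] X) ∞ (fun s : S => ρ s))
    {L₀ : TangentBundle I S → ℝ} {L : TangentBundle I S → StrongDual ℝ X → ℝ}
    (hL : RecoversLagrangian ρ γ₀ L₀ L) (ht : t₀ < t₁) {s : ℝ → S}
    (hs : ContMDiffOn 𝓘(ℝ, ℝ) I ∞ s (Icc t₀ t₁)) {ξ : ℝ → GroupLieAlgebra I S}
    (hξ : ∀ t ∈ Icc t₀ t₁, velocity I t₀ t₁ s t = mulInvariantVectorField (ξ t) (s t))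
    (hδ : 0 < δ) {V : ℝ → ℝ → S}
    (hV : ContMDiffOn 𝓘(ℝ, ℝ × ℝ) I ∞ (fun p : ℝ × ℝ => V p.1 p.2) (Ioo (-δ) δ ×ˢ Icc t₀ t₁))
    (hV0 : ∀ t ∈ Icc t₀ t₁, V 0 t = s t) :
    ∃ (η : ℝ → GroupLieAlgebra I S) (ξv : ℝ → ℝ → GroupLieAlgebra I S)
      (Γv : ℝ → ℝ → StrongDual ℝ X),
      ContDiffOn ℝ ∞ η (Icc t₀ t₁) ∧
      ContDiffOn ℝ ∞ (fun p : ℝ × ℝ => ξv p.1 p.2) (Ioo (-δ) δ ×ˢ Icc t₀ t₁) ∧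
      ContDiffOn ℝ ∞ (fun p : ℝ × ℝ => Γv p.1 p.2) (Ioo (-δ) δ ×ˢ Icc t₀ t₁) ∧
      (∀ t ∈ Icc t₀ t₁, ξv 0 t = ξ t) ∧
      (∀ t ∈ Icc t₀ t₁, Γv 0 t = dualAct ρ (s t)⁻¹ γ₀) ∧
      (∀ t ∈ Icc t₀ t₁, HasDerivAt (fun ε => ξv ε t)
        (derivWithin η (Icc t₀ t₁) t + ⁅ξ t, η t⁆) 0) ∧
      (∀ t ∈ Icc t₀ t₁, HasDerivAt (fun ε => Γv ε t)
        (-(algDualAct ρ (η t) (dualAct ρ (s t)⁻¹ γ₀))) 0) ∧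
      (∀ ε ∈ Ioo (-δ) δ, ∀ t ∈ Icc t₀ t₁, L₀ ⟨V ε t, velocity I t₀ t₁ (V ε) t⟩ =
        reducedLagrangian L (ξv ε t) (Γv ε t)) ∧
      ∀ t ∈ Icc t₀ t₁, variationField I V t = mulInvariantVectorField (η t) (V 0 t) := by
  set U : Set (ℝ × ℝ) := Ioo (-δ) δ ×ˢ Icc t₀ t₁ with hU
  set W : ℝ × ℝ → S := fun p => V p.1 p.2 with hW
  have hud : UniqueDiffOn ℝ U := (uniqueDiffOn_Ioo _ _).prod (uniqueDiffOn_Icc ht)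
  have h0 : (0 : ℝ) ∈ Ioo (-δ) δ := ⟨by linarith, hδ⟩
  have hUcl : ∀ p ∈ U, p ∈ closure (interior U) := by
    intro p hp
    rw [hU, interior_prod_eq, interior_Icc, interior_Ioo, closure_prod_eq, closure_Ioo ht.ne,
      closure_Ioo (by linarith)]
    exact ⟨Ioo_subset_Icc_self hp.1, hp.2⟩
  have hω : ContDiffOn ℝ ∞ (leftLog I W U) U := contDiffOn_leftLog hV hud
  have hW1 : ∀ p ∈ U, ContMDiffWithinAt 𝓘(ℝ, ℝ × ℝ) I 1 W U p := fun p hp =>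
    (hV p hp).of_le (by exact_mod_cast le_top)
  have hωd : ∀ p ∈ U, HasFDerivWithinAt (leftLog I W U)
      (fderivWithin ℝ (leftLog I W U) U p) U p := fun p hp =>
    (hω.differentiableOn (by simp) p hp).hasFDerivWithinAt
  -- the two coordinate lines through a point of the rectangle
  have hline₁ : ∀ ε t : ℝ, HasFDerivAt (fun x : ℝ => (x, t)) (ContinuousLinearMap.inl ℝ ℝ ℝ) ε :=
    fun ε t => hasFDerivAt_prodMk_left ε t
  have hline₂ : ∀ ε t : ℝ, HasFDerivAt (fun x : ℝ => (ε, x)) (ContinuousLinearMap.inr ℝ ℝ ℝ) t :=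
    fun ε t => hasFDerivAt_prodMk_right ε t
  have hmaps₁ : ∀ t ∈ Icc t₀ t₁, MapsTo (fun x : ℝ => (x, t)) (Ioo (-δ) δ) U :=
    fun t htt x hx => ⟨hx, htt⟩
  have hmaps₂ : ∀ ε ∈ Ioo (-δ) δ, MapsTo (fun x : ℝ => (ε, x)) (Icc t₀ t₁) U :=
    fun ε hε x hx => ⟨hε, hx⟩
  have hlog₂ : ∀ ε ∈ Ioo (-δ) δ, ∀ t ∈ Icc t₀ t₁,
      leftLog I (V ε) (Icc t₀ t₁) t 1 = leftLog I W U (ε, t) (0, 1) := by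
    intro ε hε t htt
    have := leftLog_comp (I := I) (V := W) (hW1 (ε, t) ⟨hε, htt⟩) (hline₂ ε t).hasFDerivWithinAt
      (uniqueDiffOn_Icc ht t htt) (hmaps₂ ε hε)
    exact (congrArg (fun T : ℝ →L[ℝ] E => T 1) this).trans (by simp)
  have hξω : ∀ t ∈ Icc t₀ t₁, leftLog I W U (0, t) (0, 1) = ξ t := by
    intro t htt
    rw [← hlog₂ 0 h0 t htt, leftLog_congr hV0 htt]
    exact mulInvariantVectorField_injective (s t) ((velocity_eq ht hs htt).symm.trans (hξ t htt))
  have hslice : ∀ t ∈ Icc t₀ t₁, ContMDiffAt 𝓘(ℝ, ℝ) I ∞ (fun ε => V ε t) 0 := by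
    intro t htt
    have h1 : ContMDiffOn 𝓘(ℝ, ℝ) 𝓘(ℝ, ℝ × ℝ) ∞ (fun x : ℝ => (x, t)) (Ioo (-δ) δ) :=
      (contDiff_id.prodMk contDiff_const).contMDiff.contMDiffOn
    exact (hV.comp h1 (hmaps₁ t htt)).contMDiffAt (Ioo_mem_nhds h0.1 h0.2)
  have hlog₁ : ∀ t ∈ Icc t₀ t₁,
      leftLog I (fun ε => V ε t) univ 0 1 = leftLog I W U (0, t) (1, 0) := by
    intro t htt
    have h1 := leftLog_comp (I := I) (V := W) (c := fun x : ℝ => (x, t)) (x := 0)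
      (hW1 (0, t) ⟨h0, htt⟩)
      (hline₁ 0 t).hasFDerivWithinAt (uniqueDiffOn_Ioo _ _ 0 h0) (hmaps₁ t htt)
    have h2 : leftLog I (fun ε => V ε t) univ 0 = leftLog I (fun ε => V ε t) (Ioo (-δ) δ) 0 := by
      rw [leftLog, leftLog, fderivWithin_univ, fderivWithin_of_mem_nhds (Ioo_mem_nhds h0.1 h0.2)]
    rw [h2]
    exact (congrArg (fun T : ℝ →L[ℝ] E => T 1) h1).trans (by simp)
  refine ⟨fun t => leftLog I W U (0, t) (1, 0), fun ε t => leftLog I W U (ε, t) (0, 1),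
    fun ε t => dualAct ρ (V ε t)⁻¹ γ₀, ?_, ?_, contDiffOn_dualAct_inv hρ γ₀ hV, hξω, ?_, ?_, ?_,
    ?_, ?_⟩
  · have h1 : ContDiffOn ℝ ∞ (fun t : ℝ => leftLog I W U (0, t)) (Icc t₀ t₁) :=
      hω.comp (contDiff_const.prodMk contDiff_id).contDiffOn (hmaps₂ 0 h0)
    exact h1.clm_apply (contDiffOn_const (c := ((1 : ℝ), (0 : ℝ))))
  · exact hω.clm_apply (contDiffOn_const (c := ((0 : ℝ), (1 : ℝ))))
  · intro t htt
    simp only [hV0 t htt]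
  · intro t htt
    have hp : ((0 : ℝ), t) ∈ U := ⟨h0, htt⟩
    have hmc := maurerCartan hp (hUcl _ hp) hV hud (1, 0) (0, 1) rfl (hξω t htt)
    have h1 : HasDerivAt (fun ε => leftLog I W U (ε, t) (0, 1))
        (fderivWithin ℝ (leftLog I W U) U (0, t) (1, 0) (0, 1)) 0 := by
      have := ((hωd _ hp).comp_hasDerivWithinAt (0 : ℝ)
        ((hasDerivAt_id (0 : ℝ)).prodMk (hasDerivAt_const (0 : ℝ) t)).hasDerivWithinAt
        (hmaps₁ t htt)).hasDerivAt (Ioo_mem_nhds h0.1 h0.2)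
      simpa using this.clm_apply (hasDerivAt_const (0 : ℝ) ((0 : ℝ), (1 : ℝ)))
    have h2 : HasDerivWithinAt (fun x => leftLog I W U (0, x) (1, 0))
        (fderivWithin ℝ (leftLog I W U) U (0, t) (0, 1) (1, 0)) (Icc t₀ t₁) t := by
      have := (hωd _ hp).comp_hasDerivWithinAt t
        ((hasDerivAt_const t (0 : ℝ)).prodMk (hasDerivAt_id t)).hasDerivWithinAt (hmaps₂ 0 h0)
      simpa using this.clm_apply (hasDerivWithinAt_const t (Icc t₀ t₁) ((1 : ℝ), (0 : ℝ)))
    have h3 : derivWithin (fun x => leftLog I W U (0, x) (1, 0)) (Icc t₀ t₁) t =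
        fderivWithin ℝ (leftLog I W U) U (0, t) (0, 1) (1, 0) :=
      h2.derivWithin (uniqueDiffOn_Icc ht t htt)
    rw [← h3] at hmc
    have hmc' := sub_eq_iff_eq_add'.1 hmc
    rw [hmc'] at h1
    exact h1
  · intro t htt
    have hp : ((0 : ℝ), t) ∈ U := ⟨h0, htt⟩
    obtain ⟨T, hT, hTw⟩ := hasFDerivWithinAt_dualAct_inv hρ γ₀ (hW1 _ hp)
    have h1 := (hT.comp_hasDerivWithinAt (0 : ℝ)
        ((hasDerivAt_id (0 : ℝ)).prodMk (hasDerivAt_const (0 : ℝ) t)).hasDerivWithinAt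
        (hmaps₁ t htt)).hasDerivAt (Ioo_mem_nhds h0.1 h0.2)
    rw [hTw] at h1
    simp only [hW, hV0 t htt] at h1
    exact h1
  · intro ε hε t htt
    refine Eq.trans ?_ (lagrangian_eq_reducedLagrangian hL (V ε t) (leftLog I W U (ε, t) (0, 1)))
    have h1 : ContMDiffOn 𝓘(ℝ, ℝ) I ∞ (V ε) (Icc t₀ t₁) :=
      hV.comp (contDiff_const.prodMk contDiff_id).contMDiff.contMDiffOn (hmaps₂ ε hε)
    rw [velocity_eq ht h1 htt, hlog₂ ε hε t htt]
  · intro t htt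
    rw [variationField_eq ((hslice t htt).of_le (by exact_mod_cast le_top)), hlog₁ t htt]

omit [FiniteDimensional ℝ E] in
/-- Every smooth field `η` along a curve is the left-translated variation of a deformation of that
curve: move in the chart at the identity along the straight lines with directions `η(t)`. -/
lemma exists_deformation {s : ℝ → S}
    (hs : ContMDiffOn 𝓘(ℝ, ℝ) I ∞ s (Icc t₀ t₁)) {η : ℝ → GroupLieAlgebra I S}
    (hη : ContDiffOn ℝ ∞ η (Icc t₀ t₁)) :
    ∃ (δ : ℝ) (V : ℝ → ℝ → S), 0 < δ ∧
      ContMDiffOn 𝓘(ℝ, ℝ × ℝ) I ∞ (fun p : ℝ × ℝ => V p.1 p.2) (Ioo (-δ) δ ×ˢ Icc t₀ t₁) ∧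
      (∀ t ∈ Icc t₀ t₁, V 0 t = s t) ∧
      ∀ t ∈ Icc t₀ t₁, variationField I V t = mulInvariantVectorField (η t) (V 0 t) := by
  -- `η` as a curve in the model space
  obtain ⟨ηE, hηE⟩ : ∃ ηE : ℝ → E, ηE = η := ⟨η, rfl⟩
  have hηc : ContDiffOn ℝ ∞ ηE (Icc t₀ t₁) := by rw [hηE]; exact hη
  set φ := extChartAt I (1 : S) with hφ
  obtain ⟨R, hR, hball⟩ := Metric.isOpen_iff.1 (isOpen_extChartAt_target (I := I) (1 : S)) (φ 1)
    (mem_extChartAt_target 1)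
  obtain ⟨C, hC⟩ := isCompact_Icc.exists_bound_of_continuousOn hηc.continuousOn
  -- for `|ε| < R / (|C| + 1)` the lines stay in the chart
  have hC1 : 0 < |C| + 1 := by positivity
  have hmem : ∀ ε ∈ Ioo (-(R / (|C| + 1))) (R / (|C| + 1)), ∀ t ∈ Icc t₀ t₁,
      φ 1 + ε • ηE t ∈ φ.target := by
    intro ε hε t htt
    refine hball ?_
    rw [Metric.mem_ball, dist_eq_norm, add_sub_cancel_left, norm_smul, Real.norm_eq_abs]
    have h1 : |ε| < R / (|C| + 1) := abs_lt.2 hε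
    have h2 : ‖ηE t‖ ≤ |C| + 1 := by linarith [hC t htt, le_abs_self C]
    calc |ε| * ‖ηE t‖ ≤ |ε| * (|C| + 1) := by gcongr
      _ < R / (|C| + 1) * (|C| + 1) := by gcongr
      _ = R := div_mul_cancel₀ _ hC1.ne'
  have hδ : 0 < R / (|C| + 1) := by positivity
  have hsm : ContMDiffOn 𝓘(ℝ, ℝ × ℝ) I ∞
      (fun p : ℝ × ℝ => s p.2 * φ.symm (φ 1 + p.1 • ηE p.2))
      (Ioo (-(R / (|C| + 1))) (R / (|C| + 1)) ×ˢ Icc t₀ t₁) := by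
    have h1 : ContMDiffOn 𝓘(ℝ, ℝ × ℝ) I ∞ (fun p : ℝ × ℝ => s p.2)
        (Ioo (-(R / (|C| + 1))) (R / (|C| + 1)) ×ˢ Icc t₀ t₁) :=
      hs.comp contDiff_snd.contMDiff.contMDiffOn fun p hp => hp.2
    have h2 : ContDiffOn ℝ ∞ (fun p : ℝ × ℝ => φ 1 + p.1 • ηE p.2)
        (Ioo (-(R / (|C| + 1))) (R / (|C| + 1)) ×ˢ Icc t₀ t₁) :=
      contDiffOn_const.add (contDiff_fst.contDiffOn.smul
        (hηc.comp contDiff_snd.contDiffOn fun p hp => hp.2))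
    exact h1.mul ((contMDiffOn_extChartAt_symm (I := I) (n := ∞) (1 : S)).comp h2.contMDiffOn
      fun p hp => hmem _ hp.1 _ hp.2)
  have h0 : (0 : ℝ) ∈ Ioo (-(R / (|C| + 1))) (R / (|C| + 1)) := ⟨by linarith, hδ⟩
  refine ⟨R / (|C| + 1), fun ε t => s t * φ.symm (φ 1 + ε • ηE t), hδ, hsm, fun t _ => ?_,
    fun t htt => ?_⟩
  · change s t * φ.symm (φ 1 + (0 : ℝ) • ηE t) = s t
    rw [zero_smul, add_zero, hφ, extChartAt_to_inv, mul_one]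
  · have hslice : ContMDiffAt 𝓘(ℝ, ℝ) I ∞ (fun ε : ℝ => s t * φ.symm (φ 1 + ε • ηE t)) 0 :=
      (hsm.comp (f := fun ε : ℝ => (ε, t))
        (contDiff_id.prodMk contDiff_const).contMDiff.contMDiffOn
        fun x hx => ⟨hx, htt⟩).contMDiffAt (Ioo_mem_nhds h0.1 h0.2)
    rw [variationField_eq (V := fun ε t => s t * φ.symm (φ 1 + ε • ηE t))
      (hslice.of_le (by exact_mod_cast le_top))]
    have hder : HasFDerivAt (fun ε : ℝ => φ 1 + ε • ηE t)
        ((ContinuousLinearMap.id ℝ ℝ).smulRight (ηE t)) 0 :=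
      ((hasFDerivAt_id (𝕜 := ℝ) (0 : ℝ)).smul_const (ηE t)).const_add (φ 1)
    have hlog : leftLog I (fun ε : ℝ => s t * φ.symm (φ 1 + ε • ηE t)) univ 0 =
        (ContinuousLinearMap.id ℝ ℝ).smulRight (ηE t) := by
      rw [leftLog, fderivWithin_univ]
      refine (hder.congr_of_eventuallyEq ?_).fderiv
      filter_upwards [Ioo_mem_nhds h0.1 h0.2] with ε hε
      rw [zero_smul, add_zero, ← hφ, hφ, extChartAt_to_inv, ← hφ, mul_one, inv_mul_cancel_left,
        φ.right_inv (hmem ε hε t htt)]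
    have h1 : leftLog I (fun ε : ℝ => s t * φ.symm (φ 1 + ε • ηE t)) univ 0 1 = ηE t := by
      rw [hlog]; simp
    rw [h1, hηE]

end Variations

/-! ### The Euler–Poincaré and advection equations -/

section EulerPoincare

variable {E : Type*} [NormedAddCommGroup E] [NormedSpace ℝ E]
  {H : Type*} [TopologicalSpace H] {I : ModelWithCorners ℝ E H}
  {S : Type*} [TopologicalSpace S] [ChartedSpace H S] [Group S]
  {X : Type*} [NormedAddCommGroup X] [NormedSpace ℝ X] {r : ℕ}
  {ρ : S →* (X →L[ℝ] X)} {l : GroupLieAlgebra I S → StrongDual ℝ X → ℝ}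
  {ψ : Fin r → StrongDual ℝ X → StrongDual ℝ (GroupLieAlgebra I S)} {t₀ t₁ : ℝ}
  {ξ η η' : ℝ → GroupLieAlgebra I S} {Γ Γ' : ℝ → StrongDual ℝ X}

/-- The first variation of `∫ l(ξ, Γ) dt` along `δξ = η̇ + [ξ, η]`, `δΓ = -η Γ`. -/
noncomputable def firstVariation (ρ : S →* (X →L[ℝ] X))
    (l : GroupLieAlgebra I S → StrongDual ℝ X → ℝ) (t₀ t₁ : ℝ)
    (ξ : ℝ → GroupLieAlgebra I S) (Γ : ℝ → StrongDual ℝ X) (η : ℝ → GroupLieAlgebra I S) : ℝ :=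
  ∫ t in t₀..t₁, (fderiv ℝ (fun ζ => l ζ (Γ t)) (ξ t) (derivWithin η (Icc t₀ t₁) t + ⁅ξ t, η t⁆)
    + fderiv ℝ (fun γ => l (ξ t) γ) (Γ t) (-(algDualAct ρ (η t) (Γ t))))

/-- The first variation vanishes for all smooth `η` with vanishing end points and
`⟨ψᵃ(Γ), η⟩ = 0`. -/
def IsConstrainedCritical (ρ : S →* (X →L[ℝ] X))
    (l : GroupLieAlgebra I S → StrongDual ℝ X → ℝ)
    (ψ : Fin r → StrongDual ℝ X → StrongDual ℝ (GroupLieAlgebra I S)) (t₀ t₁ : ℝ)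
    (ξ : ℝ → GroupLieAlgebra I S) (Γ : ℝ → StrongDual ℝ X) : Prop :=
  ∀ η : ℝ → GroupLieAlgebra I S, ContDiffOn ℝ ∞ η (Icc t₀ t₁) → η t₀ = 0 → η t₁ = 0 →
    (∀ t ∈ Icc t₀ t₁, ∀ a, ψ a (Γ t) (η t) = 0) → firstVariation ρ l t₀ t₁ ξ Γ η = 0

lemma firstVariation_congr (ht : t₀ < t₁) (h : EqOn η η' (Icc t₀ t₁)) :
    firstVariation ρ l t₀ t₁ ξ Γ η = firstVariation ρ l t₀ t₁ ξ Γ η' := by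
  refine intervalIntegral.integral_congr fun t htt => ?_
  rw [uIcc_of_le ht.le] at htt
  simp only [h htt, derivWithin_congr h (h htt)]

variable [FiniteDimensional ℝ E] [FiniteDimensional ℝ X] [LieGroup I ∞ S]

lemma coad_apply (ξ η : GroupLieAlgebra I S) (μ : StrongDual ℝ (GroupLieAlgebra I S)) :
    coad ξ μ η = μ ⁅ξ, η⁆ := rfl

omit [FiniteDimensional ℝ E] [LieGroup I ∞ S] in
/-- The advection term `K(δl/δΓ, Γ)` is the derivative of `l` in the direction `δΓ = -η Γ`. -/
lemma momentumMap_dualFunctionalDeriv (f : StrongDual ℝ X → ℝ) (Γ : StrongDual ℝ X)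
    (η : GroupLieAlgebra I S) :
    momentumMap ρ (dualFunctionalDeriv f Γ) Γ η = fderiv ℝ f Γ (-(algDualAct ρ η Γ)) := by
  rw [algDualAct, neg_neg, ← apply_dualFunctionalDeriv]
  rfl

/-- For smooth curves, the first variation vanishes for all admissible `η` exactly if the
Euler–Poincaré equation holds up to a combination of the constraint covectors. -/
lemma isConstrainedCritical_iff (ht : t₀ < t₁)
    (hl : ContDiff ℝ ∞ (fun p : GroupLieAlgebra I S × StrongDual ℝ X => l p.1 p.2))
    (hξ : ContDiffOn ℝ ∞ ξ (Icc t₀ t₁)) (hΓ : ContDiffOn ℝ ∞ Γ (Icc t₀ t₁))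
    (hψ : ∀ a, ContDiffOn ℝ ∞ (fun t => ψ a (Γ t)) (Icc t₀ t₁))
    (hli : ∀ t ∈ Icc t₀ t₁, LinearIndependent ℝ (fun a => ψ a (Γ t))) :
    IsConstrainedCritical ρ l ψ t₀ t₁ ξ Γ ↔
      ∃ lam : Fin r → ℝ → ℝ, ∀ t ∈ Icc t₀ t₁,
        HasDerivWithinAt (fun τ => fderiv ℝ (fun ζ => l ζ (Γ τ)) (ξ τ))
          (coad (ξ t) (fderiv ℝ (fun ζ => l ζ (Γ t)) (ξ t))
            + momentumMap ρ (dualFunctionalDeriv (fun γ => l (ξ t) γ) (Γ t)) (Γ t)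
            + ∑ a, lam a t • ψ a (Γ t))
          (Icc t₀ t₁) t := by
  have hud := uniqueDiffOn_Icc ht
  have hdl : ContDiffOn ℝ ∞
      (fun t => fderiv ℝ (fun p : GroupLieAlgebra I S × StrongDual ℝ X => l p.1 p.2) (ξ t, Γ t))
      (Icc t₀ t₁) :=
    (hl.fderiv_right (m := ∞) (by simp)).comp_contDiffOn (hξ.prodMk hΓ)
  have hd : ∀ t, HasFDerivAt (fun p : GroupLieAlgebra I S × StrongDual ℝ X => l p.1 p.2)
      (fderiv ℝ (fun p : GroupLieAlgebra I S × StrongDual ℝ X => l p.1 p.2) (ξ t, Γ t))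
      (ξ t, Γ t) := fun t => (hl.differentiable (by simp) _).hasFDerivAt
  -- the momentum `p = δl/δξ`, and the derivative `m` of `l` in the parameter
  set p : ℝ → StrongDual ℝ (GroupLieAlgebra I S) :=
    fun t => fderiv ℝ (fun ζ => l ζ (Γ t)) (ξ t) with hp
  set m : ℝ → StrongDual ℝ (StrongDual ℝ X) :=
    fun t => fderiv ℝ (fun γ => l (ξ t) γ) (Γ t) with hm
  have hps : ContDiffOn ℝ ∞ p (Icc t₀ t₁) := by
    refine (hdl.clm_comp (contDiffOn_const (c := ContinuousLinearMap.inl ℝ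
      (GroupLieAlgebra I S) (StrongDual ℝ X)))).congr fun t _ => ?_
    exact (HasFDerivAt.comp (f := fun ζ => (ζ, Γ t)) (ξ t) (hd t)
      (hasFDerivAt_prodMk_left (ξ t) (Γ t))).fderiv
  have hms : ContDiffOn ℝ ∞ m (Icc t₀ t₁) := by
    refine (hdl.clm_comp (contDiffOn_const (c := ContinuousLinearMap.inr ℝ
      (GroupLieAlgebra I S) (StrongDual ℝ X)))).congr fun t _ => ?_
    exact (HasFDerivAt.comp (f := fun γ => (ξ t, γ)) (Γ t) (hd t)
      (hasFDerivAt_prodMk_right (ξ t) (Γ t))).fderiv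
  set p' : ℝ → StrongDual ℝ (GroupLieAlgebra I S) := derivWithin p (Icc t₀ t₁) with hp'
  have hp's : ContDiffOn ℝ ∞ p' (Icc t₀ t₁) := hps.derivWithin hud (by simp)
  have hpd : ∀ t ∈ Icc t₀ t₁, HasDerivWithinAt p (p' t) (Icc t₀ t₁) t := fun t htt =>
    (hps.differentiableOn (by simp) t htt).hasDerivWithinAt
  -- the right-hand side of the unconstrained Euler–Poincaré equation `p' = R`
  set R : ℝ → StrongDual ℝ (GroupLieAlgebra I S) := fun t => coad (ξ t) (p t)
    + momentumMap ρ (dualFunctionalDeriv (fun γ => l (ξ t) γ) (Γ t)) (Γ t) with hR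
  have hRapp : ∀ t η, R t η = p t ⁅ξ t, η⁆ + m t (-(algDualAct ρ η (Γ t))) := by
    intro t η
    rw [hR, _root_.add_apply, coad_apply, momentumMap_dualFunctionalDeriv]
  have hRs : ContDiffOn ℝ ∞ R (Icc t₀ t₁) := by
    rw [contDiffOn_clm_apply]
    intro v
    simp only [hRapp]
    refine ContDiffOn.add (hps.clm_apply ?_) (hms.clm_apply ?_)
    · have : ContDiffOn ℝ ∞ (fun t => -(LinearMap.toContinuousLinearMap
          (LieAlgebra.ad ℝ (GroupLieAlgebra I S) v : GroupLieAlgebra I S →ₗ[ℝ] _)) (ξ t))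
          (Icc t₀ t₁) :=
        ((ContinuousLinearMap.contDiff _).comp_contDiffOn hξ).neg
      refine this.congr fun t _ => ?_
      exact (lie_skew _ _).symm
    · simp only [algDualAct, neg_neg]
      exact hΓ.clm_comp contDiffOn_const
  -- integration by parts moves the derivative from `η` to the momentum
  have hparts : ∀ η : ℝ → GroupLieAlgebra I S, ContDiffOn ℝ ∞ η (Icc t₀ t₁) → η t₀ = 0 →
      η t₁ = 0 → firstVariation ρ l t₀ t₁ ξ Γ η = ∫ t in t₀..t₁, (R t - p' t) (η t) := by
    intro η hη h0 h1
    have hη's : ContDiffOn ℝ ∞ (derivWithin η (Icc t₀ t₁)) (Icc t₀ t₁) :=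
      hη.derivWithin hud (by simp)
    have hc : ContinuousOn (fun t => p' t (η t) + p t (derivWithin η (Icc t₀ t₁) t))
        (Icc t₀ t₁) :=
      (hp's.continuousOn.clm_apply hη.continuousOn).add
        (hps.continuousOn.clm_apply hη's.continuousOn)
    have hint := hc.intervalIntegrable_of_Icc (μ := volume) ht.le
    have hzero : ∫ t in t₀..t₁, (p' t (η t) + p t (derivWithin η (Icc t₀ t₁) t)) = 0 := by
      rw [intervalIntegral.integral_eq_sub_of_hasDerivAt_of_le ht.le
        (f := fun t => p t (η t)) (hps.continuousOn.clm_apply hη.continuousOn) ?_ hint]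
      · simp [h0, h1]
      · intro t htt
        have htt' := Ioo_subset_Icc_self htt
        exact ((hpd t htt').clm_apply (hη.differentiableOn (by simp) t htt').hasDerivWithinAt
          ).hasDerivAt (Icc_mem_nhds htt.1 htt.2)
    have hc2 : ContinuousOn (fun t => (R t - p' t) (η t)) (Icc t₀ t₁) :=
      (hRs.continuousOn.sub hp's.continuousOn).clm_apply hη.continuousOn
    rw [← add_zero (∫ t in t₀..t₁, (R t - p' t) (η t)), ← hzero,
      ← intervalIntegral.integral_add (hc2.intervalIntegrable_of_Icc ht.le) hint]
    refine intervalIntegral.integral_congr fun t _ => ?_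
    simp only [_root_.sub_apply, hRapp, map_add]
    ring
  constructor
  · intro hcrit
    obtain ⟨lam, hlam⟩ := mem_span_of_integral_eq_zero ht (hRs.sub hp's) hψ hli
      fun η hη h0 h1 hη0 => by
        rw [← hcrit η hη h0 h1 hη0, hparts η hη h0 h1]
    refine ⟨fun a t => -lam a t, fun t htt => ?_⟩
    have h := hlam t htt
    have h2 : R t + ∑ a, -lam a t • ψ a (Γ t) = p' t := by
      ext v
      have hv := congrArg (fun T : StrongDual ℝ (GroupLieAlgebra I S) => T v) h
      simp only [_root_.sub_apply, _root_.sum_apply, _root_.smul_apply, smul_eq_mul] at hv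
      simp only [_root_.add_apply, _root_.sum_apply, _root_.smul_apply, smul_eq_mul, neg_mul,
        Finset.sum_neg_distrib]
      linarith
    exact h2 ▸ hpd t htt
  · rintro ⟨lam, hlam⟩ η hη h0 h1 hη0
    rw [hparts η hη h0 h1]
    have : ∀ t ∈ uIcc t₀ t₁, (R t - p' t) (η t) = 0 := by
      intro t htt
      rw [uIcc_of_le ht.le] at htt
      have h2 : p' t = R t + ∑ a, lam a t • ψ a (Γ t) := (hlam t htt).derivWithin (hud t htt)
      rw [h2]
      simp [_root_.sum_apply, hη0 t htt]
    rw [intervalIntegral.integral_congr (g := fun _ => (0 : ℝ)) this]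
    simp

end EulerPoincare

section Main

variable {E : Type*} [NormedAddCommGroup E] [NormedSpace ℝ E] [FiniteDimensional ℝ E]
  {H : Type*} [TopologicalSpace H] {I : ModelWithCorners ℝ E H} [I.Boundaryless]
  {S : Type*} [TopologicalSpace S] [ChartedSpace H S] [Group S] [LieGroup I ∞ S]
  {X : Type*} [NormedAddCommGroup X] [NormedSpace ℝ X]
  {ρ : S →* (X →L[ℝ] X)} {γ₀ : StrongDual ℝ X} {t₀ t₁ : ℝ}
  {s : ℝ → S} {ξ : ℝ → GroupLieAlgebra I S}

lemma leftLog_eq_and_contDiffOn_of_velocity_eq (ht : t₀ < t₁)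
    (hs : ContMDiffOn 𝓘(ℝ, ℝ) I ∞ s (Icc t₀ t₁))
    (hξ : ∀ t ∈ Icc t₀ t₁, velocity I t₀ t₁ s t = mulInvariantVectorField (ξ t) (s t)) :
    (∀ t ∈ Icc t₀ t₁, leftLog I s (Icc t₀ t₁) t 1 = ξ t) ∧ ContDiffOn ℝ ∞ ξ (Icc t₀ t₁) := by
  have h : ∀ t ∈ Icc t₀ t₁, leftLog I s (Icc t₀ t₁) t 1 = ξ t := fun t htt =>
    mulInvariantVectorField_injective (s t) ((velocity_eq ht hs htt).symm.trans (hξ t htt))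
  refine ⟨h, ?_⟩
  have h1 : ContDiffOn ℝ ∞ (fun t => leftLog I s (Icc t₀ t₁) t 1) (Icc t₀ t₁) :=
    (contDiffOn_leftLog hs (uniqueDiffOn_Icc ht)).clm_apply contDiffOn_const
  exact ContDiffOn.congr (f := fun t => leftLog I s (Icc t₀ t₁) t 1) h1
    fun t htt => (h t htt).symm

/-- The solution of the advection equation with the given initial value is `s⁻¹ γ₀`. -/
lemma advected_iff (hρ : ContMDiff I 𝓘(ℝ, X →L[ℝ] X) ∞ (fun s : S => ρ s)) (γ₀ : StrongDual ℝ X)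
    (ht : t₀ < t₁)
    (hs : ContMDiffOn 𝓘(ℝ, ℝ) I ∞ s (Icc t₀ t₁))
    (hξ : ∀ t ∈ Icc t₀ t₁, velocity I t₀ t₁ s t = mulInvariantVectorField (ξ t) (s t))
    (Γ : ℝ → StrongDual ℝ X) :
    (Γ t₀ = dualAct ρ (s t₀)⁻¹ γ₀ ∧ Advected ρ t₀ t₁ ξ Γ) ↔
      ∀ t ∈ Icc t₀ t₁, Γ t = dualAct ρ (s t)⁻¹ γ₀ := by
  obtain ⟨hlog, hξs⟩ := leftLog_eq_and_contDiffOn_of_velocity_eq ht hs hξ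
  have hsol : Advected ρ t₀ t₁ ξ (fun t => dualAct ρ (s t)⁻¹ γ₀) := by
    intro t htt
    obtain ⟨T, hT, hTw⟩ := hasFDerivWithinAt_dualAct_inv hρ γ₀
      ((hs t htt).of_le (by exact_mod_cast le_top : (1 : ℕ∞ω) ≤ ∞))
    have h1 := hT.hasDerivWithinAt
    rw [hTw, hlog t htt] at h1
    exact h1
  constructor
  · rintro ⟨h0, hadv⟩
    -- the equation is linear with a bounded coefficient, hence has unique solutions
    let v : ℝ → StrongDual ℝ X → StrongDual ℝ X := fun t γ => -(algDualAct ρ (ξ t) γ)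
    have hv : ∀ t γ, v t γ = γ.comp (algAct I ρ (ξ t)) := fun t γ => by simp [v, algDualAct]
    have hbc : ContinuousOn (fun t => algAct I ρ (ξ t)) (Icc t₀ t₁) :=
      (algAct I ρ).continuous.comp_continuousOn hξs.continuousOn
    obtain ⟨C, hC⟩ := isCompact_Icc.exists_bound_of_continuousOn hbc
    have hlip : ∀ t ∈ Ico t₀ t₁, LipschitzOnWith C.toNNReal (v t) univ := by
      intro t htt
      refine LipschitzWith.lipschitzOnWith (LipschitzWith.of_dist_le_mul fun γ γ' => ?_)
      rw [dist_eq_norm, dist_eq_norm, hv, hv, ← ContinuousLinearMap.sub_comp]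
      refine (ContinuousLinearMap.opNorm_comp_le _ _).trans ?_
      rw [mul_comm]
      gcongr
      exact (hC t (Ico_subset_Icc_self htt)).trans (Real.le_coe_toNNReal C)
    have hright : ∀ {G : ℝ → StrongDual ℝ X}, Advected ρ t₀ t₁ ξ G → ∀ t ∈ Ico t₀ t₁,
        HasDerivWithinAt G (v t (G t)) (Ici t) t := by
      intro G hG t htt
      exact (hG t (Ico_subset_Icc_self htt)).mono_of_mem_nhdsWithin
        (Icc_mem_nhdsGE_of_mem htt)
    have hcont : ∀ {G : ℝ → StrongDual ℝ X}, Advected ρ t₀ t₁ ξ G → ContinuousOn G (Icc t₀ t₁) :=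
      fun hG t htt => (hG t htt).continuousWithinAt
    exact ODE_solution_unique_of_mem_Icc_right (s := fun _ => univ) hlip (hcont hadv)
      (hright hadv) (fun _ _ => mem_univ _) (hcont hsol) (hright hsol) (fun _ _ => mem_univ _) h0
  · intro h
    refine ⟨h t₀ (left_mem_Icc.2 ht.le), fun t htt => ?_⟩
    rw [h t htt]
    exact (hsol t htt).congr h (h t htt)

end Main

/-! ### The equivalence -/

section Main

variable {E : Type*} [NormedAddCommGroup E] [NormedSpace ℝ E] [FiniteDimensional ℝ E]
  {H : Type*} [TopologicalSpace H] {I : ModelWithCorners ℝ E H} [I.Boundaryless]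
  {S : Type*} [TopologicalSpace S] [ChartedSpace H S] [Group S] [LieGroup I ∞ S]
  {X : Type*} [NormedAddCommGroup X] [NormedSpace ℝ X]
  {ρ : S →* (X →L[ℝ] X)} {γ₀ : StrongDual ℝ X} {t₀ t₁ : ℝ}
  {s : ℝ → S} {ξ : ℝ → GroupLieAlgebra I S} {r : ℕ}
  {L₀ : TangentBundle I S → ℝ} {L : TangentBundle I S → StrongDual ℝ X → ℝ}
  {D : (s : S) → Submodule ℝ (TangentSpace I s)}
  {Ψ₀ : Fin r → (s : S) → TangentSpace I s →L[ℝ] ℝ}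
  {Ψ : Fin r → (s : S) → StrongDual ℝ X → TangentSpace I s →L[ℝ] ℝ}

/-- The unreduced principle amounts to the constraint on the reduced velocity together with the
vanishing of the first variation of the reduced action. -/
lemma lagrangeDAlembert_iff (hρ : ContMDiff I 𝓘(ℝ, X →L[ℝ] X) ∞ (fun s : S => ρ s))
    (hL : RecoversLagrangian ρ γ₀ L₀ L) (hΨ : RecoversConstraints ρ γ₀ D Ψ₀ Ψ) (ht : t₀ < t₁)
    (hs : ContMDiffOn 𝓘(ℝ, ℝ) I ∞ s (Icc t₀ t₁))
    (hξ : ∀ t ∈ Icc t₀ t₁, velocity I t₀ t₁ s t = mulInvariantVectorField (ξ t) (s t)) :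
    LagrangeDAlembert L₀ D t₀ t₁ s ↔
      (∀ t ∈ Icc t₀ t₁, ∀ a, reducedForm Ψ a (dualAct ρ (s t)⁻¹ γ₀) (ξ t) = 0) ∧
      IsConstrainedCritical ρ (reducedLagrangian L) (reducedForm Ψ) t₀ t₁ ξ
        (fun t => dualAct ρ (s t)⁻¹ γ₀) := by
  have hl := contDiff_reducedLagrangian hL
  refine and_congr (forall₂_congr fun t htt => ?_) ⟨fun h η hη h0 h1 hη0 => ?_,
    fun h δ V hδ hV hV0 hv0 hv1 hvD => ?_⟩
  · rw [hξ t htt, mem_distribution_iff hΨ]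
  · obtain ⟨δ, V, hδ, hV, hV0, hvar⟩ := exists_deformation hs hη
    obtain ⟨η', ξv, Γv, -, hξv, hΓv, hξ0, hΓ0, hdξ, hdΓ, hact, hvar'⟩ :=
      exists_reduced_deformation hρ hL ht hs hξ hδ hV hV0
    have hηη : EqOn η' η (Icc t₀ t₁) := fun t htt =>
      mulInvariantVectorField_injective (V 0 t) ((hvar' t htt).symm.trans (hvar t htt))
    have hz : ∀ g : S, mulInvariantVectorField (0 : GroupLieAlgebra I S) g = 0 := fun g =>
      map_zero _
    have hzero := h δ V hδ hV hV0
      (by rw [hvar t₀ (left_mem_Icc.2 ht.le), h0, hz])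
      (by rw [hvar t₁ (right_mem_Icc.2 ht.le), h1, hz])
      (fun t htt => by
        have htt' := Ioo_subset_Icc_self htt
        rw [hvar t htt', mem_distribution_iff hΨ, hV0 t htt']
        exact hη0 t htt')
    have hder := hasDerivAt_action hl ht hδ hξv hΓv hξ0 hΓ0 hdξ hdΓ
    rw [← firstVariation_congr ht hηη]
    refine hder.unique (hzero.congr_of_eventuallyEq ?_)
    filter_upwards [Ioo_mem_nhds (by linarith : -δ < 0) hδ] with ε hε
    refine intervalIntegral.integral_congr fun t htt => ?_
    rw [uIcc_of_le ht.le] at htt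
    exact (hact ε hε t htt).symm
  · obtain ⟨η, ξv, Γv, hη, hξv, hΓv, hξ0, hΓ0, hdξ, hdΓ, hact, hvar⟩ :=
      exists_reduced_deformation hρ hL ht hs hξ hδ hV hV0
    have hz : ∀ g : S, mulInvariantVectorField (0 : GroupLieAlgebra I S) g = 0 := fun g =>
      map_zero _
    have h0 : η t₀ = 0 := mulInvariantVectorField_injective (V 0 t₀)
      (((hvar t₀ (left_mem_Icc.2 ht.le)).symm.trans hv0).trans (hz _).symm)
    have h1 : η t₁ = 0 := mulInvariantVectorField_injective (V 0 t₁)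
      (((hvar t₁ (right_mem_Icc.2 ht.le)).symm.trans hv1).trans (hz _).symm)
    have hη0 : ∀ t ∈ Icc t₀ t₁, ∀ a, reducedForm Ψ a (dualAct ρ (s t)⁻¹ γ₀) (η t) = 0 := by
      intro t htt
      rcases eq_endpoints_or_mem_Ioo_of_mem_Icc htt with rfl | rfl | htt'
      · simp [h0]
      · simp [h1]
      · have := hvD t htt'
        rwa [hvar t htt, mem_distribution_iff hΨ, hV0 t htt] at this
    have hder := hasDerivAt_action hl ht hδ hξv hΓv hξ0 hΓ0 hdξ hdΓ
    have hcrit : _ = (0 : ℝ) := h η hη h0 h1 hη0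
    rw [firstVariation] at hcrit
    rw [hcrit] at hder
    refine hder.congr_of_eventuallyEq ?_
    filter_upwards [Ioo_mem_nhds (by linarith : -δ < 0) hδ] with ε hε
    refine intervalIntegral.integral_congr fun t htt => ?_
    rw [uIcc_of_le ht.le] at htt
    exact hact ε hε t htt

/-- The reduced principle amounts to the constraint together with the vanishing of the first
variation of the reduced action. -/
lemma reducedLagrangeDAlembert_iff (hρ : ContMDiff I 𝓘(ℝ, X →L[ℝ] X) ∞ (fun s : S => ρ s))
    (hL : RecoversLagrangian ρ γ₀ L₀ L) (ht : t₀ < t₁)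
    (hs : ContMDiffOn 𝓘(ℝ, ℝ) I ∞ s (Icc t₀ t₁))
    (hξ : ∀ t ∈ Icc t₀ t₁, velocity I t₀ t₁ s t = mulInvariantVectorField (ξ t) (s t)) :
    ReducedLagrangeDAlembert ρ (reducedLagrangian L) (reducedForm Ψ) t₀ t₁ ξ
        (fun t => dualAct ρ (s t)⁻¹ γ₀) ↔
      (∀ t ∈ Icc t₀ t₁, ∀ a, reducedForm Ψ a (dualAct ρ (s t)⁻¹ γ₀) (ξ t) = 0) ∧
      IsConstrainedCritical ρ (reducedLagrangian L) (reducedForm Ψ) t₀ t₁ ξ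
        (fun t => dualAct ρ (s t)⁻¹ γ₀) := by
  have hl := contDiff_reducedLagrangian hL
  refine and_congr Iff.rfl ⟨fun h η hη h0 h1 hη0 => ?_,
    fun h η hη h0 h1 hη0 δ ξv Γv hδ hξv hΓv hξ0 hΓ0 hdξ hdΓ => ?_⟩
  · obtain ⟨δ, V, hδ, hV, hV0, hvar⟩ := exists_deformation hs hη
    obtain ⟨η', ξv, Γv, -, hξv, hΓv, hξ0, hΓ0, hdξ, hdΓ, -, hvar'⟩ :=
      exists_reduced_deformation hρ hL ht hs hξ hδ hV hV0
    have hηη : EqOn η' η (Icc t₀ t₁) := fun t htt =>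
      mulInvariantVectorField_injective (V 0 t) ((hvar' t htt).symm.trans (hvar t htt))
    rw [← firstVariation_congr ht hηη]
    refine (hasDerivAt_action hl ht hδ hξv hΓv hξ0 hΓ0 hdξ hdΓ).unique
      (h η hη h0 h1 hη0 δ ξv Γv hδ hξv hΓv hξ0 hΓ0 (fun t htt => ?_) fun t htt => ?_)
    · rw [← hηη htt, ← derivWithin_congr hηη (hηη htt)]
      exact hdξ t htt
    · rw [← hηη htt]
      exact hdΓ t htt
  · have hder := hasDerivAt_action hl ht hδ hξv hΓv hξ0 hΓ0 hdξ hdΓ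
    have hcrit : _ = (0 : ℝ) := h η hη h0 h1 hη0
    rw [firstVariation] at hcrit
    rwa [hcrit] at hder

/-- The nonholonomic Euler–Poincaré equations for some advected parameter amount to the constraint
together with the vanishing of the first variation of the reduced action. -/
lemma exists_nonholonomicEulerPoincare_iff [FiniteDimensional ℝ X]
    (hρ : ContMDiff I 𝓘(ℝ, X →L[ℝ] X) ∞ (fun s : S => ρ s))
    (hL : RecoversLagrangian ρ γ₀ L₀ L) (hΨ : RecoversConstraints ρ γ₀ D Ψ₀ Ψ) (ht : t₀ < t₁)
    (hs : ContMDiffOn 𝓘(ℝ, ℝ) I ∞ s (Icc t₀ t₁))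
    (hrank : ∀ t ∈ Icc t₀ t₁, LinearIndependent ℝ (fun a => Ψ₀ a (s t)))
    (hξ : ∀ t ∈ Icc t₀ t₁, velocity I t₀ t₁ s t = mulInvariantVectorField (ξ t) (s t)) :
    (∃ Γ : ℝ → StrongDual ℝ X, Γ t₀ = dualAct ρ (s t₀)⁻¹ γ₀ ∧
        NonholonomicEulerPoincare ρ (reducedLagrangian L) (reducedForm Ψ) t₀ t₁ ξ Γ) ↔
      (∀ t ∈ Icc t₀ t₁, ∀ a, reducedForm Ψ a (dualAct ρ (s t)⁻¹ γ₀) (ξ t) = 0) ∧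
      IsConstrainedCritical ρ (reducedLagrangian L) (reducedForm Ψ) t₀ t₁ ξ
        (fun t => dualAct ρ (s t)⁻¹ γ₀) := by
  have hΓs : ContDiffOn ℝ ∞ (fun t => dualAct ρ (s t)⁻¹ γ₀) (Icc t₀ t₁) :=
    contDiffOn_dualAct_inv hρ γ₀ hs
  rw [isConstrainedCritical_iff ht (contDiff_reducedLagrangian hL)
    (leftLog_eq_and_contDiffOn_of_velocity_eq ht hs hξ).2 hΓs
    (fun a => contDiffOn_reducedForm hΨ a hΓs)
    (fun t htt => linearIndependent_reducedForm hΨ (s t) (hrank t htt))]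
  constructor
  · rintro ⟨Γ, hΓ0, hcon, ⟨lam, hlam⟩, hadv⟩
    have hΓ := (advected_iff hρ γ₀ ht hs hξ Γ).1 ⟨hΓ0, hadv⟩
    refine ⟨fun t htt a => hΓ t htt ▸ hcon t htt a, lam, fun t htt => ?_⟩
    have h := hlam t htt
    rw [hΓ t htt] at h
    exact h.congr (fun τ hτ => by simp only [hΓ τ hτ]) (by simp only [hΓ t htt])
  · rintro ⟨hcon, hlam⟩
    obtain ⟨h0, hadv⟩ := (advected_iff hρ γ₀ ht hs hξ (fun t => dualAct ρ (s t)⁻¹ γ₀)).2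
      fun _ _ => rfl
    exact ⟨_, h0, hcon, hlam, hadv⟩

end Main

end BrokenSymmetry

theorem mainTheorem6
    {E : Type*} [NormedAddCommGroup E] [NormedSpace ℝ E] [FiniteDimensional ℝ E]
    {H : Type*} [TopologicalSpace H] (I : ModelWithCorners ℝ E H) [I.Boundaryless]
    {S : Type*} [TopologicalSpace S] [ChartedSpace H S] [Group S] [LieGroup I ∞ S]
    {X : Type*} [NormedAddCommGroup X] [NormedSpace ℝ X] [FiniteDimensional ℝ X]
    (ρ : S →* (X →L[ℝ] X)) (hρ : ContMDiff I 𝓘(ℝ, X →L[ℝ] X) ∞ (fun s : S => ρ s))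
    (γ₀ : StrongDual ℝ X)
    (L₀ : TangentBundle I S → ℝ) (L : TangentBundle I S → StrongDual ℝ X → ℝ)
    (hL : BrokenSymmetry.RecoversLagrangian ρ γ₀ L₀ L)
    {r : ℕ} (D : (s : S) → Submodule ℝ (TangentSpace I s))
    (Ψ₀ : Fin r → (s : S) → TangentSpace I s →L[ℝ] ℝ)
    (Ψ : Fin r → (s : S) → StrongDual ℝ X → TangentSpace I s →L[ℝ] ℝ)
    (hΨ : BrokenSymmetry.RecoversConstraints ρ γ₀ D Ψ₀ Ψ)
    {t₀ t₁ : ℝ} (ht : t₀ < t₁)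
    (s : ℝ → S) (hs : ContMDiffOn 𝓘(ℝ, ℝ) I ∞ s (Set.Icc t₀ t₁))
    -- `D` has corank `r` along the curve
    (hrank : ∀ t ∈ Set.Icc t₀ t₁, LinearIndependent ℝ (fun a => Ψ₀ a (s t)))
    (ξ : ℝ → GroupLieAlgebra I S)
    -- `ξ = s⁻¹ ṡ`, that is, `ṡ = s ξ`
    (hξ : ∀ t ∈ Set.Icc t₀ t₁,
      BrokenSymmetry.velocity I t₀ t₁ s t = mulInvariantVectorField (ξ t) (s t)) :
    List.TFAE [
      BrokenSymmetry.LagrangeDAlembert L₀ D t₀ t₁ s,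
      BrokenSymmetry.ReducedLagrangeDAlembert ρ (BrokenSymmetry.reducedLagrangian L)
        (BrokenSymmetry.reducedForm Ψ) t₀ t₁ ξ
        (fun t => BrokenSymmetry.dualAct ρ (s t)⁻¹ γ₀),
      ∃ Γ : ℝ → StrongDual ℝ X, Γ t₀ = BrokenSymmetry.dualAct ρ (s t₀)⁻¹ γ₀ ∧
        BrokenSymmetry.NonholonomicEulerPoincare ρ (BrokenSymmetry.reducedLagrangian L)
          (BrokenSymmetry.reducedForm Ψ) t₀ t₁ ξ Γ] ∧
    -- the curve `Γ` in the third statement is the one of the second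
    ∀ Γ : ℝ → StrongDual ℝ X,
      (Γ t₀ = BrokenSymmetry.dualAct ρ (s t₀)⁻¹ γ₀ ∧ BrokenSymmetry.Advected ρ t₀ t₁ ξ Γ) ↔
        ∀ t ∈ Set.Icc t₀ t₁, Γ t = BrokenSymmetry.dualAct ρ (s t)⁻¹ γ₀ := by
  refine ⟨?_, BrokenSymmetry.advected_iff hρ γ₀ ht hs hξ⟩
  tfae_have 1 ↔ 2 := (BrokenSymmetry.lagrangeDAlembert_iff hρ hL hΨ ht hs hξ).trans
    (BrokenSymmetry.reducedLagrangeDAlembert_iff hρ hL ht hs hξ).symm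
  tfae_have 2 ↔ 3 := (BrokenSymmetry.reducedLagrangeDAlembert_iff hρ hL ht hs hξ).trans
    (BrokenSymmetry.exists_nonholonomicEulerPoincare_iff hρ hL hΨ ht hs hrank hξ).symm
  tfae_finish
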